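/- Time is measured in bit operations for programs with finitely many integer registers (no arrays), where an addition, subtraction or comparison costs the total binary length of its operands, and a multiplication or integer division costs the product of their lengths. The input is an integer $X\ge 2$; "finding" a finite set of pairs $(x,y)$ means halting after having output exactly the elements of that set. (1) There is an absolute exponent $B$ such that for every rational $C>0$ there are a program and a constant $A$ such that, for every integer $X\ge2$, the program finds all $(x,y)\in\mathbf{Z}^2$ with $0\le x\le X$ and $0<|x^3-y^2|\le C x^{1/2}$ in time at most $A\,X^{1/2}(\log X)^B$. (2) More generally, there is an absolute exponent $B$ such that for all positive integers $a,b$ (for instance $a=4$, $b=3$) and every rational $C>0$ there are a program and a constant $A$ such that, for every integer $X\ge2$, the program finds all $(x,y)\in\mathbf{Z}^2$ with $x\le X$ and $0<|ax^3-by^2|\le C x$ in time at most $A\,X^{1/2}(\log X)^B$. (3) For every real $C$ there is a constant $A$ such that for every real $X\ge 2$ the set of all $(x,y)\in\mathbf{Z}^2$ with $x\le X$ and $|x^3-y^2|\le Cx$ is finite and has at most $A\,X^{1/2}\log X$ elements. -/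

import Mathlib

/-!
A machine model with bit cost: programs over finitely many integer registers (no arrays, no
indirect addressing), in which every arithmetic operation is charged by the binary length of its
operands as in schoolbook arithmetic.  Keeping each register on a tape of its own, a multitape
Turing machine carries out such a program in time proportional to the cost defined here.
-/

namespace BitCost

/-- Contents of the registers. A program mentions only finitely many of them. -/
abbrev State := ℕ → ℤ

/-- The number of bits of an integer, with one more for the sign. -/
def len (n : ℤ) : ℕ := n.natAbs.size + 1

/-- Arithmetic expressions in the registers. -/
inductive Expr where
  | const (n : ℤ)
  | reg (i : ℕ)
  | add (e f : Expr)
  | sub (e f : Expr)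
  | mul (e f : Expr)
  | div (e f : Expr)

/-- The value of an expression. Division is integer division with nonnegative remainder, and
division by zero gives zero. -/
def Expr.eval (s : State) : Expr → ℤ
  | .const n => n
  | .reg i => s i
  | .add e f => e.eval s + f.eval s
  | .sub e f => e.eval s - f.eval s
  | .mul e f => e.eval s * f.eval s
  | .div e f => e.eval s / f.eval s

/-- The number of bit operations for evaluating an expression: linear in the lengths of the
operands for addition and subtraction, the product of the lengths for multiplication and division,
and the length of the number for fetching a constant or a register. -/
def Expr.cost (s : State) : Expr → ℕ
  | .const n => len n
  | .reg i => len (s i)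
  | .add e f => e.cost s + f.cost s + (len (e.eval s) + len (f.eval s))
  | .sub e f => e.cost s + f.cost s + (len (e.eval s) + len (f.eval s))
  | .mul e f => e.cost s + f.cost s + len (e.eval s) * len (f.eval s)
  | .div e f => e.cost s + f.cost s + len (e.eval s) * len (f.eval s)

/-- Programs. `emit e f` writes the pair of values of `e` and `f` to the output,
`ifPos e p q` runs `p` if `e` is positive and `q` otherwise, and
`whilePos e p` repeats `p` as long as `e` is positive. -/
inductive Prog where
  | skip
  | assign (i : ℕ) (e : Expr)
  | emit (e f : Expr)
  | seq (p q : Prog)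
  | ifPos (e : Expr) (p q : Prog)
  | whilePos (e : Expr) (p : Prog)

/-- `Runs p s s' out t`: started in the state `s`, the program `p` halts in the state `s'`, having
written the list `out`, after `t` bit operations. -/
inductive Runs : Prog → State → State → List (ℤ × ℤ) → ℕ → Prop where
  | skip (s : State) : Runs .skip s s [] 1
  | assign (i : ℕ) (e : Expr) (s : State) :
      Runs (.assign i e) s (Function.update s i (e.eval s)) [] (e.cost s + 1)
  | emit (e f : Expr) (s : State) :
      Runs (.emit e f) s s [(e.eval s, f.eval s)] (e.cost s + f.cost s + 1)
  | seq {p q : Prog} {s s' s'' : State} {o o' : List (ℤ × ℤ)} {t t' : ℕ}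
      (hp : Runs p s s' o t) (hq : Runs q s' s'' o' t') :
      Runs (.seq p q) s s'' (o ++ o') (t + t' + 1)
  | ifPos_pos {e : Expr} {p q : Prog} {s s' : State} {o : List (ℤ × ℤ)} {t : ℕ}
      (he : 0 < e.eval s) (hp : Runs p s s' o t) :
      Runs (.ifPos e p q) s s' o (e.cost s + t + 1)
  | ifPos_nonpos {e : Expr} {p q : Prog} {s s' : State} {o : List (ℤ × ℤ)} {t : ℕ}
      (he : e.eval s ≤ 0) (hq : Runs q s s' o t) :
      Runs (.ifPos e p q) s s' o (e.cost s + t + 1)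
  | whilePos_pos {e : Expr} {p : Prog} {s s' s'' : State} {o o' : List (ℤ × ℤ)} {t t' : ℕ}
      (he : 0 < e.eval s) (hp : Runs p s s' o t) (hw : Runs (.whilePos e p) s' s'' o' t') :
      Runs (.whilePos e p) s s'' (o ++ o') (e.cost s + t + t' + 1)
  | whilePos_nonpos {e : Expr} {p : Prog} {s : State} (he : e.eval s ≤ 0) :
      Runs (.whilePos e p) s s [] (e.cost s + 1)

/-- The initial state on input `X`: register `0` holds `X`, all others hold `0`. -/
def input (X : ℕ) : State := fun i => if i = 0 then (X : ℤ) else 0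

/-- On input `X` the program `P` halts after at most `T` bit operations, and the pairs that it has
written are exactly the elements of `S`. -/
def Prog.Finds (P : Prog) (X : ℕ) (S : Set (ℤ × ℤ)) (T : ℝ) : Prop :=
  ∃ (s' : State) (out : List (ℤ × ℤ)) (t : ℕ),
    Runs P (input X) s' out t ∧ (∀ v : ℤ × ℤ, v ∈ out ↔ v ∈ S) ∧ (t : ℝ) ≤ T

end BitCost

/-! After rescaling, every part asks for pairs with `x ≥ 1` and `|x^3 - y^2| ≤ c x`. With `y ≥ 0`
and `ρ = √x`, such a `y` is very close to `ρ^3`, so the cubic `T^3 - 3xT + 2y` is nearly `(T - ρ)^2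
(T + 2ρ)`. Fix a scale `Q` with `Q^4 ≤ x < 16 Q^4`. Dirichlet gives `P / q` with `q ≤ Q` and `|P -
qρ| ≤ 1 / (Q + 1)`. Put `d = P^3 - 3xPq^2 + 2yq^3`, `H = 3(P^2 - xq^2)`, `Z = 3P`. Then `d = O(q)`,
`H = O(qQ)`, `0 < Z = O(qQ^2)` and, because of the near double root, `H^2 - 4dZ = O(q^4)`; moreover
`x` and `y` are rational expressions in `q, d, H, Z` (`exists_coords`).

Only the residue `p` of `P` modulo `q` is enumerated, so that the fractions are the Farey fractions
in `[0, 1)`. The residue `p` fixes `d` modulo `q`; then `d` fixes `H` modulo `q^2`, and `d` and `H`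
fix `Z` modulo `q^3`; the quotients are integers `C`, `B`, `A`. There are `O(1)` values of `C` and
`O(Q / q)` values of `B`. For given `C`, `B`, the last coordinate lies in a window of width `O(Q^2
q^2 / (H^2 + q^4) + 1)`: a large `H` forces `Z` to be near `H^2 / (4d)`, and for small `H` the bound
on `Z` suffices (`third_window`). As `B` varies, `H` moves in steps of `q^2`, so the windows add up
to `O(Q^2 / q^2)` (`sum_halfWidth_le`).

Summing over the fractions gives `O(Q^2 log Q)` (`sum_fareyFrom_le`), and over `Q = 1, 2, 4, ...` it
gives `O(X^(1/2) log X)` candidates. The Farey recurrence produces the fractions without storage,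
and each candidate costs `O((log X)^2)` bit operations, whence the exponent `3`. The candidates are
tested exactly before being written. The counting statement comes from the length of the output of
the same search with no tests. -/

namespace BitCost

/-! ### Sizes of registers and costs of expressions -/

section

/-- Exponents bounding the contents of the registers of the search program. -/
def regDeg : ℕ → ℕ
  | 7 => 5
  | 8 => 7
  | 9 => 4
  | 10 => 11
  | 11 => 15
  | 12 => 6
  | 13 => 33
  | 14 => 8
  | 15 => 38
  | 16 => 77
  | 17 => 119
  | 18 => 30
  | _ => 1

/-- An exponent bounding the value of an expression. -/
def Expr.deg : Expr → ℕ
  | .const _ => 1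
  | .reg i => regDeg i
  | .add e f => max e.deg f.deg + 1
  | .sub e f => max e.deg f.deg + 1
  | .mul e f => e.deg + f.deg
  | .div e _ => e.deg

/-- A coefficient bounding the cost of an expression. -/
def Expr.coef : Expr → ℕ
  | .const _ => 3
  | .reg i => regDeg i + 2
  | .add e f => e.coef + f.coef + ((e.deg + 2) + (f.deg + 2))
  | .sub e f => e.coef + f.coef + ((e.deg + 2) + (f.deg + 2))
  | .mul e f => e.coef + f.coef + (e.deg + 2) * (f.deg + 2)
  | .div e f => e.coef + f.coef + (e.deg + 2) * (f.deg + 2)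

/-- All constants of an expression are at most `M` in absolute value. -/
def Expr.ConstLE (M : ℕ) : Expr → Prop
  | .const n => n.natAbs ≤ M
  | .reg _ => True
  | .add e f => e.ConstLE M ∧ f.ConstLE M
  | .sub e f => e.ConstLE M ∧ f.ConstLE M
  | .mul e f => e.ConstLE M ∧ f.ConstLE M
  | .div e f => e.ConstLE M ∧ f.ConstLE M

theorem Expr.ConstLE.mono {M M' : ℕ} (h : M ≤ M') : ∀ {e : Expr}, e.ConstLE M → e.ConstLE M'
  | .const _, he => le_trans he h
  | .reg _, _ => trivial
  | .add _ _, he => ⟨he.1.mono h, he.2.mono h⟩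
  | .sub _ _, he => ⟨he.1.mono h, he.2.mono h⟩
  | .mul _ _, he => ⟨he.1.mono h, he.2.mono h⟩
  | .div _ _, he => ⟨he.1.mono h, he.2.mono h⟩

theorem Expr.exists_constLE : ∀ e : Expr, ∃ M, e.ConstLE M
  | .const n => ⟨n.natAbs, le_rfl⟩
  | .reg _ => ⟨0, trivial⟩
  | .add e f | .sub e f | .mul e f | .div e f =>
    let ⟨M, hM⟩ := e.exists_constLE
    let ⟨M', hM'⟩ := f.exists_constLE
    ⟨max M M', hM.mono (le_max_left _ _), hM'.mono (le_max_right _ _)⟩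

/-- Every register is bounded by its power of `M`. -/
def Bounded (M : ℕ) (s : State) : Prop := ∀ i, (s i).natAbs ≤ M ^ regDeg i

theorem Bounded.update {M : ℕ} {s : State} (hs : Bounded M s) {i : ℕ} {v : ℤ}
    (hv : v.natAbs ≤ M ^ regDeg i) : Bounded M (Function.update s i v) := by
  intro j
  rcases eq_or_ne j i with rfl | h
  · simpa using hv
  · simpa [h] using hs j

theorem natAbs_add_le_pow {M a b : ℕ} (hM : 2 ≤ M) {u v w : ℤ} (hu : u.natAbs ≤ M ^ a)
    (hv : v.natAbs ≤ M ^ b) (hw : w.natAbs ≤ u.natAbs + v.natAbs) :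
    w.natAbs ≤ M ^ (max a b + 1) := by
  have h1 : M ^ a ≤ M ^ max a b := Nat.pow_le_pow_right (by omega) (le_max_left _ _)
  have h2 : M ^ b ≤ M ^ max a b := Nat.pow_le_pow_right (by omega) (le_max_right _ _)
  have h3 : M ^ max a b * 2 ≤ M ^ max a b * M := Nat.mul_le_mul le_rfl hM
  rw [pow_succ]
  omega

theorem Expr.natAbs_eval_le {M : ℕ} (hM : 2 ≤ M) {s : State} (hs : Bounded M s) :
    ∀ {e : Expr}, e.ConstLE M → (e.eval s).natAbs ≤ M ^ e.deg
  | .const n, he => by simpa [Expr.eval, Expr.deg, Expr.ConstLE] using he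
  | .reg i, _ => hs i
  | .add e f, he => natAbs_add_le_pow hM (natAbs_eval_le hM hs he.1) (natAbs_eval_le hM hs he.2)
      (Int.natAbs_add_le _ _)
  | .sub e f, he => natAbs_add_le_pow hM (natAbs_eval_le hM hs he.1) (natAbs_eval_le hM hs he.2)
      (Int.natAbs_sub_le _ _)
  | .mul e f, he => by
      rw [Expr.eval, Int.natAbs_mul, Expr.deg, pow_add]
      exact Nat.mul_le_mul (natAbs_eval_le hM hs he.1) (natAbs_eval_le hM hs he.2)
  | .div e f, he => by
      refine le_trans ?_ (natAbs_eval_le (e := e) hM hs he.1)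
      exact Int.natAbs_ediv_le_natAbs _ _

theorem len_le_of_natAbs_le_pow {M a : ℕ} (hM : 2 ≤ M) {v : ℤ} (hv : v.natAbs ≤ M ^ a) :
    len v ≤ (a + 2) * M.size := by
  have h1 : v.natAbs < 2 ^ (a * M.size + 1) := by
    calc v.natAbs ≤ M ^ a := hv
      _ ≤ (2 ^ M.size) ^ a := Nat.pow_le_pow_left (Nat.lt_size_self M).le a
      _ = 2 ^ (a * M.size) := by rw [← pow_mul, mul_comm]
      _ < _ := Nat.pow_lt_pow_right (by norm_num) (by omega)
  have h2 := Nat.size_le.2 h1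
  have h3 : 1 ≤ M.size := Nat.lt_size.2 (by simpa using by omega)
  unfold len
  nlinarith

/-- The coefficient depends only on the shape of the expression, so a fixed program pays a constant
multiple of `M.size ^ 2` per evaluation. This is where the two additional logarithms in the running
time come from. -/
theorem Expr.cost_le {M : ℕ} (hM : 2 ≤ M) {s : State} (hs : Bounded M s) :
    ∀ {e : Expr}, e.ConstLE M → e.cost s ≤ e.coef * M.size ^ 2 := by
  have h3 : 1 ≤ M.size := Nat.lt_size.2 (by simpa using by omega)
  have h4 : M.size ≤ M.size ^ 2 := by nlinarith
  have hlen {e : Expr} (he : e.ConstLE M) : len (e.eval s) ≤ (e.deg + 2) * M.size :=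
    len_le_of_natAbs_le_pow hM (e.natAbs_eval_le hM hs he)
  intro e
  induction e with
  | const n => intro he; exact (hlen he).trans (Nat.mul_le_mul le_rfl h4)
  | reg i => intro he; exact (hlen he).trans (Nat.mul_le_mul le_rfl h4)
  | add e f ihe ihf | sub e f ihe ihf =>
    intro he
    have h5 := (hlen he.1).trans (Nat.mul_le_mul le_rfl h4)
    have h6 := (hlen he.2).trans (Nat.mul_le_mul le_rfl h4)
    have h7 := ihe he.1
    have h8 := ihf he.2
    simp only [Expr.cost, Expr.coef]
    linarith
  | mul e f ihe ihf | div e f ihe ihf =>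
    intro he
    have h5 := Nat.mul_le_mul (hlen he.1) (hlen he.2)
    have h7 := ihe he.1
    have h8 := ihf he.2
    simp only [Expr.cost, Expr.coef]
    linarith

/-! ### Rules for time and output of programs -/

/-- From the state `s` the program `P` halts within `W` units of time, a unit being the square of
the length of `M`; it writes at most `W` pairs, all in `S` and comprising `D`, and the final state
satisfies `R`. -/
def Spec (M : ℕ) (S : Set (ℤ × ℤ)) (P : Prog) (s : State) (W : ℝ) (D : Set (ℤ × ℤ))
    (R : State → Prop) : Prop :=
  ∃ (s' : State) (o : List (ℤ × ℤ)) (t : ℕ), Runs P s s' o t ∧ (t : ℝ) ≤ W * (M.size : ℝ) ^ 2 ∧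
    (o.length : ℝ) ≤ W ∧ (∀ v ∈ o, v ∈ S) ∧ (∀ v ∈ D, v ∈ o) ∧ R s'

variable {M : ℕ} {S : Set (ℤ × ℤ)}

theorem one_le_size_sq (hM : 2 ≤ M) : (1 : ℝ) ≤ (M.size : ℝ) ^ 2 := by
  have h3 : 1 ≤ M.size := Nat.lt_size.2 (by simpa using by omega)
  have : (1 : ℝ) ≤ M.size := by exact_mod_cast h3
  exact one_le_pow₀ this

theorem Spec.mono {P : Prog} {s : State} {W W' : ℝ} {D D' : Set (ℤ × ℤ)} {R R' : State → Prop}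
    (h : Spec M S P s W D R) (hW : W ≤ W') (hD : D' ⊆ D) (hR : ∀ s', R s' → R' s') :
    Spec M S P s W' D' R' := by
  obtain ⟨s', o, t, h1, h2, h3, h4, h5, h6⟩ := h
  exact ⟨s', o, t, h1, h2.trans (by gcongr), h3.trans hW, h4, fun v hv => h5 v (hD hv), hR _ h6⟩

theorem Spec.seq (hM : 2 ≤ M) {P Q : Prog} {s : State} {W W' : ℝ} {D D' : Set (ℤ × ℤ)}
    {R R' : State → Prop} (hP : Spec M S P s W D R) (hQ : ∀ s', R s' → Spec M S Q s' W' D' R') :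
    Spec M S (.seq P Q) s (W + W' + 1) (D ∪ D') R' := by
  obtain ⟨s', o, t, h1, h2, h3, h4, h5, h6⟩ := hP
  obtain ⟨s'', o', t', k1, k2, k3, k4, k5, k6⟩ := hQ s' h6
  have := one_le_size_sq hM
  refine ⟨s'', o ++ o', _, .seq h1 k1, ?_, ?_, ?_, ?_, k6⟩
  · push_cast; linarith
  · rw [List.length_append]; push_cast; linarith
  · intro v hv
    rcases List.mem_append.1 hv with hv | hv
    exacts [h4 v hv, k4 v hv]
  · rintro v (hv | hv)
    exacts [List.mem_append_left _ (h5 v hv), List.mem_append_right _ (k5 v hv)]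

theorem Expr.cost_le_real (hM : 2 ≤ M) {s : State} (hs : Bounded M s) {e : Expr}
    (he : e.ConstLE M) : (e.cost s : ℝ) ≤ e.coef * (M.size : ℝ) ^ 2 := by
  exact_mod_cast e.cost_le hM hs he

theorem Spec.assign (hM : 2 ≤ M) {s : State} (hs : Bounded M s) {i : ℕ} {e : Expr}
    (he : e.ConstLE M) : Spec M S (.assign i e) s (e.coef + 1) ∅
      (fun s' => s' = Function.update s i (e.eval s)) := by
  refine ⟨_, _, _, .assign i e s, ?_, ?_, by simp, by simp, rfl⟩
  · have := one_le_size_sq hM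
    have := e.cost_le_real hM hs he
    push_cast; linarith
  · simp; positivity

/-- An assignment followed by a program. -/
theorem Spec.assign_seq (hM : 2 ≤ M) {s : State} (hs : Bounded M s) {i : ℕ} {e : Expr} {P : Prog}
    {W : ℝ} {D : Set (ℤ × ℤ)} {R : State → Prop} (he : e.ConstLE M)
    (hd : (e.eval s).natAbs ≤ M ^ regDeg i)
    (hP : ∀ s', Bounded M s' → s' i = e.eval s → (∀ j, j ≠ i → s' j = s j) →
      Spec M S P s' W D R) :
    Spec M S (.seq (.assign i e) P) s (e.coef + 2 + W) D R := by
  refine (Spec.seq hM (Spec.assign hM hs he) (by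
    rintro _ rfl
    exact hP _ (hs.update hd) (by simp) (fun j hj => by simp [hj]))).mono ?_ ?_ ?_
  · linarith
  · simp
  · simp

theorem Expr.natAbs_eval_le_regDeg (hM : 2 ≤ M) {s : State} (hs : Bounded M s) {e : Expr}
    (he : e.ConstLE M) {i : ℕ} (h : e.deg ≤ regDeg i) : (e.eval s).natAbs ≤ M ^ regDeg i :=
  (e.natAbs_eval_le hM hs he).trans (Nat.pow_le_pow_right (by omega) h)

theorem Bounded.dec {s : State} (hs : Bounded M s) {i : ℕ} (h : 0 < s i) :
    Bounded M (Function.update s i (s i - 1)) :=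
  hs.update (le_trans (by omega) (hs i))

theorem Spec.skip (hM : 2 ≤ M) (s : State) : Spec M S .skip s 1 ∅ (fun s' => s' = s) :=
  ⟨_, _, _, .skip s, by simpa using one_le_size_sq hM, by simp, by simp, by simp, rfl⟩

theorem Spec.emit (hM : 2 ≤ M) {s : State} (hs : Bounded M s) {e f : Expr}
    (he : e.ConstLE M) (hf : f.ConstLE M) (hS : (e.eval s, f.eval s) ∈ S) :
    Spec M S (.emit e f) s (e.coef + f.coef + 1) {(e.eval s, f.eval s)} (fun s' => s' = s) := by
  refine ⟨_, _, _, .emit e f s, ?_, ?_, by simpa using hS, by simp, rfl⟩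
  · have := one_le_size_sq hM
    have := e.cost_le_real hM hs he
    have := f.cost_le_real hM hs hf
    push_cast; linarith
  · simp; positivity

theorem Spec.ifPos (hM : 2 ≤ M) {s : State} (hs : Bounded M s) {e : Expr} (he : e.ConstLE M)
    {P Q : Prog} {W : ℝ} {D : Set (ℤ × ℤ)} {R : State → Prop}
    (hP : 0 < e.eval s → Spec M S P s W D R) (hQ : e.eval s ≤ 0 → Spec M S Q s W D R) :
    Spec M S (.ifPos e P Q) s (e.coef + 1 + W) D R := by
  have h0 := one_le_size_sq hM
  have h00 := e.cost_le_real hM hs he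
  have h01 : (0 : ℝ) ≤ e.coef := by positivity
  rcases lt_or_ge 0 (e.eval s) with h | h
  · obtain ⟨s', o, t, h1, h2, h3, h4, h5, h6⟩ := hP h
    exact ⟨s', o, _, .ifPos_pos h h1, by push_cast; linarith, by linarith, h4, h5, h6⟩
  · obtain ⟨s', o, t, h1, h2, h3, h4, h5, h6⟩ := hQ h
    exact ⟨s', o, _, .ifPos_nonpos h h1, by push_cast; linarith, by linarith, h4, h5, h6⟩

theorem Spec.while_stop (hM : 2 ≤ M) {s : State} (hs : Bounded M s) {e : Expr} (he : e.ConstLE M)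
    {P : Prog} (h : e.eval s ≤ 0) :
    Spec M S (.whilePos e P) s (e.coef + 1) ∅ (fun s' => s' = s) := by
  have h0 := one_le_size_sq hM
  have h00 := e.cost_le_real hM hs he
  exact ⟨_, _, _, .whilePos_nonpos h, by push_cast; linarith, by simp; positivity, by simp,
    by simp, rfl⟩

theorem Spec.while_step (hM : 2 ≤ M) {s : State} (hs : Bounded M s) {e : Expr} (he : e.ConstLE M)
    {P : Prog} {W W' : ℝ} {D D' : Set (ℤ × ℤ)} {R R' : State → Prop} (h : 0 < e.eval s)
    (hP : Spec M S P s W D R) (hw : ∀ s', R s' → Spec M S (.whilePos e P) s' W' D' R') :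
    Spec M S (.whilePos e P) s (e.coef + 1 + W + W') (D ∪ D') R' := by
  obtain ⟨s', o, t, h1, h2, h3, h4, h5, h6⟩ := hP
  obtain ⟨s'', o', t', k1, k2, k3, k4, k5, k6⟩ := hw s' h6
  have h0 := one_le_size_sq hM
  have h00 := e.cost_le_real hM hs he
  have h01 : (0 : ℝ) ≤ e.coef := by positivity
  refine ⟨s'', o ++ o', _, .whilePos_pos h h1 k1, ?_, ?_, ?_, ?_, k6⟩
  · push_cast; linarith
  · rw [List.length_append]; push_cast; linarith
  · intro v hv
    rcases List.mem_append.1 hv with hv | hv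
    exacts [h4 v hv, k4 v hv]
  · rintro v (hv | hv)
    exacts [List.mem_append_left _ (h5 v hv), List.mem_append_right _ (k5 v hv)]

/-- A loop governed by a counter. `I` is the invariant; `W j` and `D j` are the work and the output
at counter `j`. -/
theorem Spec.forLoop (hM : 2 ≤ M) {i : ℕ} {P : Prog} {I : State → Prop} {W : ℕ → ℝ}
    {D : ℕ → Set (ℤ × ℤ)} (hI : ∀ s, I s → Bounded M s)
    (hP : ∀ (j : ℕ) (s : State), 1 ≤ j → s i = j → I s →
      Spec M S P s (W j) (D j) (fun s' => I s' ∧ s' i = j))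
    (hdec : ∀ s, I s → 0 < s i → I (Function.update s i (s i - 1))) :
    ∀ (n : ℕ) (s : State), s i = n → I s →
      Spec M S (.whilePos (.reg i) (.seq P (.assign i (.sub (.reg i) (.const 1))))) s
        (∑ j ∈ Finset.Icc 1 n, (W j + (3 * regDeg i + 20)) + (regDeg i + 3))
        (⋃ j ∈ Finset.Icc 1 n, D j) I := by
  intro n
  induction n with
  | zero =>
    intro s hi hs
    refine (Spec.while_stop hM (hI s hs) (e := .reg i) trivial ?_).mono ?_ ?_ ?_
    · simp [Expr.eval, hi]
    · simp [Expr.coef]; ring_nf; rfl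
    · simp
    · rintro _ rfl; exact hs
  | succ n ih =>
    intro s hi hs
    have hc : (Expr.sub (.reg i) (.const 1)).ConstLE M := ⟨trivial, by simp [Expr.ConstLE]; omega⟩
    refine (Spec.while_step hM (hI s hs) (e := .reg i) trivial (by simp [Expr.eval, hi])
      (Spec.seq hM (hP (n + 1) s (by omega) hi hs) (fun s' hs' =>
        (Spec.assign hM (hI s' hs'.1) hc).mono le_rfl le_rfl
          (R' := fun s'' => I s'' ∧ s'' i = n) ?_)) (fun s' hs' => ih s' hs'.2 hs'.1)).mono ?_ ?_ ?_
    · rintro _ rfl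
      refine ⟨?_, ?_⟩
      · have := hdec s' hs'.1 (by rw [hs'.2]; positivity)
        simpa [Expr.eval] using this
      · simp [Expr.eval, hs'.2]
    · rw [Finset.sum_Icc_succ_top (by omega)]
      have h1 : (regDeg i : ℝ) ≥ 1 := by
        have : 1 ≤ regDeg i := by unfold regDeg; split <;> norm_num
        exact_mod_cast this
      have h2 : (max (regDeg i) 1 : ℕ) = regDeg i := max_eq_left (by exact_mod_cast h1)
      simp only [Expr.coef, Expr.deg]
      push_cast
      linarith
    · intro v hv
      simp only [Set.mem_iUnion, Finset.mem_Icc] at hv ⊢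
      obtain ⟨j, hj, hv⟩ := hv
      rcases Nat.lt_or_ge n j with h | h
      · obtain rfl : j = n + 1 := by omega
        exact Or.inl (Or.inl hv)
      · right
        simp only [Set.mem_iUnion]
        exact ⟨j, ⟨hj.1, h⟩, hv⟩
    · exact fun _ h => h

end

/-! ### The coordinates of a near-solution -/

set_option maxHeartbeats 1000000 in
/-- The triple of intervals in which the coordinates of a near-solution lie, together with the
formulas recovering it. -/
theorem exists_coords {c Q q x y p r s P : ℤ} (hc : 1 ≤ c) (hQ : 1 ≤ Q) (hq : 1 ≤ q) (hqQ : q ≤ Q)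
    (hrs : r * q - p * s = 1) (hx1 : Q ^ 4 ≤ x) (hx2 : x < 16 * Q ^ 4) (hy : 0 ≤ y)
    (hxy : |x ^ 3 - y ^ 2| ≤ c * x) (hP : P % q = p)
    (hd : |(P : ℝ) - q * Real.sqrt x| ≤ 1 / (Q + 1)) :
    ∃ C B A d H Z : ℤ, d = p ^ 3 + q * C ∧ H = 3 * p ^ 2 + q * (q * B - 2 * s * C) ∧
      Z = 3 * p + q * s * (C * s - B * q) + q ^ 3 * A ∧
      q ^ 2 * x * 9 = Z ^ 2 - 3 * H ∧ 54 * q ^ 3 * y = 27 * d - Z ^ 3 + 27 * x * q ^ 2 * Z ∧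
      |d| ≤ (13 + 2 * c) * q ∧ |H| ≤ 27 * q * Q ∧ 0 < Z ∧ Z ≤ 15 * q * Q ^ 2 ∧
      |H ^ 2 - 4 * d * Z| ≤ 3 * (17 + 16 * c) * q ^ 4 := by
  obtain ⟨m, rfl⟩ : ∃ m, P = p + q * m := ⟨P / q, by rw [← hP]; exact (Int.emod_add_mul_ediv P q).symm⟩
  clear hP
  set h := x - m ^ 2 with hh
  -- Translating by `m` turns `T^3 - 3xT + 2y` into `T^3 + 3mT^2 - 3hT + k`.
  set k := 2 * y - 2 * m ^ 3 - 3 * m * h with hk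
  -- The translated cubic form is `u^3 + v G(u, v)` with `G = 3m u^2 - 3h uv + k v^2`. The witnesses
  -- are the coefficients of `G` in the unimodular basis `(p, q)`, `(r, s)`: its value at `(p, q)`,
  -- the polar value, and its value at `(r, s)`.
  refine ⟨3 * m * p ^ 2 - 3 * h * p * q + k * q ^ 2,
    6 * m * r * p - 3 * h * (r * q + p * s) + 2 * k * s * q,
    3 * m * r ^ 2 - 3 * h * r * s + k * s ^ 2, _, _, _, rfl, rfl, rfl, ?_⟩
  have eH : 3 * p ^ 2 + q * (q * (6 * m * r * p - 3 * h * (r * q + p * s) + 2 * k * s * q) -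
      2 * s * (3 * m * p ^ 2 - 3 * h * p * q + k * q ^ 2)) = 3 * ((p + q * m) ^ 2 - x * q ^ 2) := by
    linear_combination (6 * m * p * q - 3 * h * q ^ 2) * hrs - 3 * q ^ 2 * hh
  have eZ : 3 * p + q * s * ((3 * m * p ^ 2 - 3 * h * p * q + k * q ^ 2) * s -
      (6 * m * r * p - 3 * h * (r * q + p * s) + 2 * k * s * q) * q) +
      q ^ 3 * (3 * m * r ^ 2 - 3 * h * r * s + k * s ^ 2) = 3 * (p + q * m) := by
    linear_combination (3 * q * m * (r * q - p * s + 1)) * hrs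
  have ed : p ^ 3 + q * (3 * m * p ^ 2 - 3 * h * p * q + k * q ^ 2) =
      (p + q * m) ^ 3 - 3 * x * (p + q * m) * q ^ 2 + 2 * y * q ^ 3 := by
    rw [hk, hh]; ring
  rw [eH, eZ, ed]
  clear eH eZ ed
  clear_value h k
  generalize p + q * m = P at *
  refine ⟨by ring, by ring, ?_⟩
  set ρ := Real.sqrt x with hρ
  have hQr : (1 : ℝ) ≤ Q := by exact_mod_cast hQ
  have hqr : (1 : ℝ) ≤ q := by exact_mod_cast hq
  have hqQr : (q : ℝ) ≤ Q := by exact_mod_cast hqQ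
  have hcr : (1 : ℝ) ≤ c := by exact_mod_cast hc
  have hyr : (0 : ℝ) ≤ y := by exact_mod_cast hy
  have hx1r : ((Q : ℝ) ^ 2) ^ 2 ≤ x := by rw [← pow_mul]; exact_mod_cast hx1
  have hx2r : (x : ℝ) ≤ (4 * (Q : ℝ) ^ 2) ^ 2 := by
    have : (x : ℝ) ≤ 16 * (Q : ℝ) ^ 4 := by exact_mod_cast hx2.le
    nlinarith
  have hx0 : (0 : ℝ) ≤ x := le_trans (by positivity) hx1r
  have hρ2 : ρ ^ 2 = x := Real.sq_sqrt hx0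
  have hρ1 : (Q : ℝ) ^ 2 ≤ ρ := Real.le_sqrt_of_sq_le hx1r
  have hρ4 : ρ ≤ 4 * (Q : ℝ) ^ 2 := (Real.sqrt_le_left (by positivity)).2 hx2r
  have hρ0 : 1 ≤ ρ := le_trans (by nlinarith) hρ1
  obtain ⟨η, hη⟩ : ∃ η : ℝ, (y : ℝ) = ρ ^ 3 + η := ⟨y - ρ ^ 3, by ring⟩
  obtain ⟨δ, hδ⟩ : ∃ δ : ℝ, (P : ℝ) = q * ρ + δ := ⟨P - q * ρ, by ring⟩
  have hδQ : |δ| * (Q + 1) ≤ 1 := by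
    have : |δ| ≤ 1 / (Q + 1) := by rw [hδ] at hd; simpa using hd
    rwa [le_div_iff₀ (by linarith)] at this
  -- In `x^3 - y^2 = -η (y + ρ^3)` the second factor is at least `ρ^3`.
  have hηρ : |η| * ρ ≤ c := by
    have h1 : |(x : ℝ) ^ 3 - y ^ 2| ≤ c * x := by exact_mod_cast hxy
    have h2 : (x : ℝ) ^ 3 - y ^ 2 = -(η * (y + ρ ^ 3)) := by rw [← hρ2, hη]; ring
    rw [h2, abs_neg, abs_mul, abs_of_nonneg (by positivity : (0 : ℝ) ≤ y + ρ ^ 3)] at h1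
    have h3 : |η| * ρ ^ 3 ≤ c * ρ ^ 2 := by
      rw [hρ2]; refine le_trans ?_ h1; gcongr; linarith
    have h4 : (|η| * ρ) * ρ ^ 2 ≤ c * ρ ^ 2 := by linarith
    exact le_of_mul_le_mul_right h4 (by positivity)
  have δ0 := abs_nonneg δ
  have η0 := abs_nonneg η
  have hδQ1 : |δ| * Q ≤ 1 := by nlinarith
  have hδ1 : |δ| ≤ 1 / 2 := by nlinarith
  have hδδ : |δ| ^ 2 ≤ 1 := by nlinarith
  have hδ3 : |δ| ^ 3 ≤ 1 := pow_le_one₀ δ0 (by linarith)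
  have hδ4 : |δ| ^ 4 ≤ 1 := pow_le_one₀ δ0 (by linarith)
  have hN : (q : ℝ) * ρ ≤ 4 * q * Q ^ 2 := by nlinarith
  have hN1 : 1 ≤ (q : ℝ) * ρ := by nlinarith
  have e1 : |δ| * (q * ρ) ≤ 4 * q * Q := by
    calc |δ| * (q * ρ) ≤ |δ| * (4 * q * Q ^ 2) := by gcongr
      _ = (|δ| * Q) * (4 * q * Q) := by ring
      _ ≤ 1 * (4 * q * Q) := by gcongr
      _ = _ := by ring
  have e2 : |δ| ^ 2 * (q * ρ) ≤ 4 * q := by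
    calc |δ| ^ 2 * (q * ρ) = |δ| * (|δ| * (q * ρ)) := by ring
      _ ≤ |δ| * (4 * q * Q) := by gcongr
      _ = (|δ| * Q) * (4 * q) := by ring
      _ ≤ 1 * (4 * q) := by gcongr
      _ = _ := by ring
  have e3 : |δ| ^ 3 * (q * ρ) ≤ 4 := by
    calc |δ| ^ 3 * (q * ρ) = |δ| * (|δ| ^ 2 * (q * ρ)) := by ring
      _ ≤ |δ| * (4 * q) := by gcongr
      _ ≤ |δ| * (4 * Q) := by gcongr
      _ = (|δ| * Q) * 4 := by ring
      _ ≤ 1 * 4 := by gcongr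
      _ = _ := by ring
  -- This uses `q^2 ≤ Q^2 ≤ ρ`, the point at which the restriction `q ≤ Q` controls the error of
  -- `y`.
  have e4 : |η| * q ^ 3 ≤ c * q := by
    have : |η| * q ^ 2 ≤ c := by
      refine le_trans ?_ hηρ
      gcongr
      refine le_trans ?_ hρ1
      gcongr
    nlinarith
  refine ⟨?_, ?_, ?_, ?_, ?_⟩
  -- For `η = 0` this value would be `(P - qρ)^2 (P + 2qρ) = δ^2 (3qρ + δ)`.
  · have : (((P ^ 3 - 3 * x * P * q ^ 2 + 2 * y * q ^ 3 : ℤ)) : ℝ) =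
        3 * (δ ^ 2 * (q * ρ)) + δ ^ 3 + 2 * (η * q ^ 3) := by
      push_cast; rw [hδ, hη, ← hρ2]; ring
    have h5 : |3 * (δ ^ 2 * (q * ρ)) + δ ^ 3 + 2 * (η * q ^ 3)| ≤ (13 + 2 * (c : ℝ)) * q := by
      refine (abs_add_three _ _ _).trans ?_
      have a1 : |3 * (δ ^ 2 * (q * ρ))| = 3 * (|δ| ^ 2 * (q * ρ)) := by
        rw [abs_mul, abs_mul, abs_pow, abs_of_nonneg (by linarith : 0 ≤ q * ρ)]; simp
      have a2 : |2 * (η * q ^ 3)| = 2 * (|η| * q ^ 3) := by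
        rw [abs_mul, abs_mul, abs_of_nonneg (by positivity : (0 : ℝ) ≤ q ^ 3)]; simp
      rw [a1, a2, abs_pow]
      have a3 : (13 + 2 * (c : ℝ)) * q = 3 * (4 * q) + q + 2 * (c * q) := by ring
      rw [a3]
      linarith
    rw [← this] at h5
    exact_mod_cast h5
  · have : (((3 * (P ^ 2 - x * q ^ 2) : ℤ)) : ℝ) = 6 * (δ * (q * ρ)) + 3 * δ ^ 2 := by
      push_cast; rw [hδ, ← hρ2]; ring
    have h5 : |6 * (δ * (q * ρ)) + 3 * δ ^ 2| ≤ 27 * (q : ℝ) * Q := by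
      refine (abs_add_le _ _).trans ?_
      rw [abs_mul, abs_mul, abs_of_nonneg (by linarith : 0 ≤ q * ρ), abs_mul, abs_pow]
      have : (1 : ℝ) ≤ q * Q := by nlinarith
      have a3 : 27 * (q : ℝ) * Q = 6 * (4 * q * Q) + 3 * (q * Q) := by ring
      rw [a3, abs_of_pos (by norm_num : (0 : ℝ) < 6), abs_of_pos (by norm_num : (0 : ℝ) < 3)]
      linarith
    rw [← this] at h5
    exact_mod_cast h5
  · have h5 : (0 : ℝ) < P := by rw [hδ]; linarith [neg_abs_le δ]
    have : 0 < P := by exact_mod_cast h5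
    linarith
  · have h5 : (3 * P : ℝ) ≤ 15 * q * Q ^ 2 := by
      have : (1 : ℝ) ≤ q * Q ^ 2 := by nlinarith [mul_pos (by linarith : (0:ℝ) < q) (by linarith : (0:ℝ) < Q)]
      rw [hδ]; linarith [le_abs_self δ]
    exact_mod_cast h5
  -- The leading terms `36 δ^2 (qρ)^2` of `H^2` and of `4dZ` cancel, because the root is nearly
  -- double; what remains is bounded through `e3` and `hηρ`.
  · have : ((((3 * (P ^ 2 - x * q ^ 2)) ^ 2 -
        4 * (P ^ 3 - 3 * x * P * q ^ 2 + 2 * y * q ^ 3) * (3 * P) : ℤ)) : ℝ) =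
        -(12 * (δ ^ 3 * (q * ρ)) + 3 * δ ^ 4 + 24 * (η * P * q ^ 3)) := by
      push_cast; rw [hδ, hη, ← hρ2]; ring
    have h5 : |12 * (δ ^ 3 * (q * ρ)) + 3 * δ ^ 4 + 24 * (η * P * q ^ 3)| ≤
        3 * (17 + 16 * (c : ℝ)) * (q : ℝ) ^ 4 := by
      refine (abs_add_three _ _ _).trans ?_
      have a1 : |12 * (δ ^ 3 * (q * ρ))| = 12 * (|δ| ^ 3 * (q * ρ)) := by
        rw [abs_mul, abs_mul, abs_pow, abs_of_nonneg (by linarith : 0 ≤ q * ρ)]; simp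
      have hP0 : (0 : ℝ) ≤ P := by rw [hδ]; linarith [neg_abs_le δ]
      have a2 : |24 * (η * P * q ^ 3)| = 24 * (|η| * P * q ^ 3) := by
        rw [abs_mul, abs_mul, abs_mul, abs_of_nonneg (by positivity : (0 : ℝ) ≤ q ^ 3),
          abs_of_nonneg hP0]; simp
      have a3 : |3 * δ ^ 4| = 3 * |δ| ^ 4 := by rw [abs_mul, abs_pow]; simp
      rw [a1, a2, a3]
      have a4 : |η| * P * q ^ 3 ≤ 2 * c * q ^ 4 := by
        calc |η| * P * q ^ 3 ≤ |η| * (2 * (q * ρ)) * q ^ 3 := by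
              gcongr; rw [hδ]; linarith [le_abs_self δ]
          _ = 2 * (|η| * ρ) * q ^ 4 := by ring
          _ ≤ 2 * c * q ^ 4 := by gcongr
      have a5 : (1 : ℝ) ≤ q ^ 4 := one_le_pow₀ hqr
      have a6 : 3 * (17 + 16 * (c : ℝ)) * (q : ℝ) ^ 4 = 51 * q ^ 4 + 24 * (2 * c * q ^ 4) := by ring
      rw [a6]
      linarith
    rw [← abs_neg, ← this] at h5
    exact_mod_cast h5

/-! ### Windows for the three coordinates -/

theorem ediv_mul_bounds (a : ℤ) {b : ℤ} (hb : 0 < b) : b * (a / b) ≤ a ∧ a < b * (a / b) + b :=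
  ⟨Int.mul_ediv_self_le hb.ne', Int.lt_mul_ediv_self_add hb⟩

/-- The half-width of the window for the last coordinate. -/
def halfWidth (K Q q H : ℤ) : ℤ := 60 * K * Q ^ 2 * q ^ 2 / (H ^ 2 + q ^ 4) + 3

/-- One of the three units added in `halfWidth` pays for its own floor. The other two are kept for
the floor in `centre` and for the division by `q ^ 3` in `third_window`. -/
theorem halfWidth_mul_lt {K Q q H : ℤ} (hq : 1 ≤ q) :
    60 * K * Q ^ 2 * q ^ 2 < (H ^ 2 + q ^ 4) * (halfWidth K Q q H - 2) := by
  have hY : 0 < H ^ 2 + q ^ 4 := by positivity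
  have := (ediv_mul_bounds (60 * K * Q ^ 2 * q ^ 2) hY).2
  unfold halfWidth
  linarith

theorem three_le_halfWidth {K Q q H : ℤ} (hK : 0 ≤ K) : 3 ≤ halfWidth K Q q H := by
  have : 0 ≤ 60 * K * Q ^ 2 * q ^ 2 / (H ^ 2 + q ^ 4) :=
    Int.ediv_nonneg (by positivity) (by positivity)
  unfold halfWidth
  linarith

theorem halfWidth_le {K Q q H : ℤ} (hq : 1 ≤ q) :
    (halfWidth K Q q H : ℝ) ≤ 60 * K * Q ^ 2 * q ^ 2 / (H ^ 2 + q ^ 4) + 3 := by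
  have hY : 0 < H ^ 2 + q ^ 4 := by positivity
  have h := (ediv_mul_bounds (60 * K * Q ^ 2 * q ^ 2) hY).1
  have hY' : (0 : ℝ) < H ^ 2 + q ^ 4 := by exact_mod_cast hY
  have h' : ((H : ℝ) ^ 2 + q ^ 4) * ((60 * K * Q ^ 2 * q ^ 2 / (H ^ 2 + q ^ 4) : ℤ) : ℝ) ≤
      60 * K * Q ^ 2 * q ^ 2 := by exact_mod_cast h
  unfold halfWidth
  push_cast
  gcongr
  rw [le_div_iff₀ hY', mul_comm]
  exact h'

/-- The centre of the window for `Z`, used if `H` is large. -/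
def centre (K q d H : ℤ) : ℤ := if 0 < H ^ 2 - 2 * K * q ^ 4 then H ^ 2 / (4 * d) else 0

theorem first_window {D q N C d : ℤ} (hq : 1 ≤ q) (hd : d = N + q * C) (h : |d| ≤ D * q) :
    -(D + 1) ≤ C + N / q ∧ C + N / q ≤ D := by
  obtain ⟨h1, h2⟩ := ediv_mul_bounds N (by omega : 0 < q)
  obtain ⟨h3, h4⟩ := abs_le.1 h
  constructor
  · have : q * (-(D + 1)) ≤ q * (C + N / q) := by linarith
    exact le_of_mul_le_mul_left this (by omega)
  · have : q * (C + N / q) ≤ q * D := by linarith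
    exact le_of_mul_le_mul_left this (by omega)

theorem second_window {Q q u B H : ℤ} (hq : 1 ≤ q) (hH : H = q ^ 2 * B - u)
    (h : |H| ≤ 27 * q * Q) :
    -(27 * Q / q + 1) ≤ B - u / q ^ 2 ∧ B - u / q ^ 2 ≤ 27 * Q / q + 2 := by
  have hq2 : 0 < q ^ 2 := by positivity
  obtain ⟨h1, h2⟩ := ediv_mul_bounds u hq2
  obtain ⟨h5, h6⟩ := ediv_mul_bounds (27 * Q) (by omega : 0 < q)
  obtain ⟨h3, h4⟩ := abs_le.1 h
  have h7 : q * (27 * Q) ≤ q * (q * (27 * Q / q) + q) := by gcongr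
  constructor
  · have : q ^ 2 * (-(27 * Q / q + 1)) ≤ q ^ 2 * (B - u / q ^ 2) := by linarith
    exact le_of_mul_le_mul_left this hq2
  · have : q ^ 2 * (B - u / q ^ 2) ≤ q ^ 2 * (27 * Q / q + 2) := by linarith
    exact le_of_mul_le_mul_left this hq2

/-- If `H^2 > 2Kq^4`, then `4dZ` is at least `H^2 / 2`. Hence `d` is positive, the bound on `Z`
gives `d` a lower bound of order `H^2 / (qQ^2)`, and dividing `|H^2 - 4dZ| ≤ Kq^4` by `4d` localizes
`Z`. Otherwise `H^2 + q^4 ≤ 3Kq^4`, and the window about `0` is already long enough to contain all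
of `(0, 15qQ^2]`. -/
theorem third_window {K Q q d H Z z A : ℤ} (hK : 1 ≤ K) (hq : 1 ≤ q)
    (hZ : Z = z + q ^ 3 * A) (hZ0 : 0 < Z) (hZQ : Z ≤ 15 * q * Q ^ 2)
    (h : |H ^ 2 - 4 * d * Z| ≤ K * q ^ 4) :
    |A - (centre K q d H - z) / q ^ 3| ≤ halfWidth K Q q H := by
  have hq3 : 0 < q ^ 3 := by positivity
  have hV := halfWidth_mul_lt (K := K) (Q := Q) (H := H) hq
  have hV3 := three_le_halfWidth (K := K) (Q := Q) (q := q) (H := H) (by omega)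
  generalize halfWidth K Q q H = V at *
  obtain ⟨h1, h2⟩ := ediv_mul_bounds (centre K q d H - z) hq3
  generalize ha : (centre K q d H - z) / q ^ 3 = a at *
  have hY : 0 < H ^ 2 + q ^ 4 := by positivity
  have key : -(q ^ 3 * (V - 2)) ≤ Z - centre K q d H ∧
      Z - centre K q d H ≤ q ^ 3 * (V - 2) + 1 := by
    unfold centre
    split_ifs with hc
    · obtain ⟨h3, h4⟩ := abs_le.1 h
      have h5 : H ^ 2 ≤ 2 * (4 * d * Z) := by linarith
      have hH : 0 < H ^ 2 := by nlinarith [pow_pos (by omega : 0 < q) 4]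
      have hd : 0 < d := by
        by_contra hd
        nlinarith [mul_nonneg (by omega : 0 ≤ -d) hZ0.le]
      obtain ⟨h6, h7⟩ := ediv_mul_bounds (H ^ 2) (by omega : 0 < 4 * d)
      generalize H ^ 2 / (4 * d) = t at *
      have h8 : H ^ 2 + q ^ 4 ≤ 4 * d * (60 * q * Q ^ 2) := by
        have : d * Z ≤ d * (15 * q * Q ^ 2) := by gcongr
        nlinarith [pow_pos (by omega : 0 < q) 4]
      have h9 : K * q ^ 4 ≤ 4 * d * (q ^ 3 * (V - 2)) := by
        refine le_of_mul_le_mul_right ?_ hY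
        calc K * q ^ 4 * (H ^ 2 + q ^ 4) ≤ K * q ^ 4 * (4 * d * (60 * q * Q ^ 2)) := by gcongr
          _ = 4 * d * q ^ 3 * (60 * K * Q ^ 2 * q ^ 2) := by ring
          _ ≤ 4 * d * q ^ 3 * ((H ^ 2 + q ^ 4) * (V - 2)) := by gcongr
          _ = _ := by ring
      constructor
      · have : 4 * d * (-(q ^ 3 * (V - 2))) ≤ 4 * d * (Z - t) := by linarith
        exact le_of_mul_le_mul_left this (by omega)
      · have : 4 * d * (Z - t) ≤ 4 * d * (q ^ 3 * (V - 2) + 1) := by linarith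
        exact le_of_mul_le_mul_left this (by omega)
    · have h8 : 15 * q * Q ^ 2 ≤ q ^ 3 * (V - 2) := by
        have h10 : (H ^ 2 + q ^ 4) * (V - 2) ≤ (3 * K * q ^ 4) * (V - 2) := by
          refine mul_le_mul_of_nonneg_right ?_ (by omega)
          nlinarith [pow_pos (by omega : 0 < q) 4]
        have h11 : (3 * K * q) * (15 * q * Q ^ 2) ≤ (3 * K * q) * (q ^ 3 * (V - 2)) := by
          nlinarith [mul_nonneg (mul_nonneg (by omega : 0 ≤ K) (sq_nonneg Q)) (sq_nonneg q)]
        exact le_of_mul_le_mul_left h11 (by positivity)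
      have : 0 ≤ q ^ 3 * (V - 2) := mul_nonneg hq3.le (by omega)
      constructor <;> linarith
  rw [abs_le]
  constructor
  · have : q ^ 3 * (-V) ≤ q ^ 3 * (A - a) := by linarith [key.1]
    exact le_of_mul_le_mul_left this hq3
  · have : q ^ 3 * (A - a) ≤ q ^ 3 * V := by linarith [key.2]
    exact le_of_mul_le_mul_left this hq3

/-! ### Summing the lengths of the windows -/

/-- A telescoping majorant: `v / (1 + |v|)` is increasing and bounded by `1` in absolute value, so
sums of the left side over unit steps are bounded whatever the starting point and the number of
terms. -/
theorem inv_sq_add_one_le (v : ℝ) :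
    1 / (v ^ 2 + 1) ≤ 4 * ((v + 1) / (1 + |v + 1|) - v / (1 + |v|)) := by
  rcases le_or_gt 0 v with h | h
  · rw [abs_of_nonneg h, abs_of_nonneg (by linarith : 0 ≤ v + 1),
      div_sub_div _ _ (by positivity) (by positivity), mul_div_assoc', div_le_div_iff₀ (by positivity) (by positivity)]
    nlinarith [sq_nonneg (v - 1)]
  · rcases le_or_gt 0 (v + 1) with h' | h'
    · rw [abs_of_neg h, abs_of_nonneg h', div_sub_div _ _ (by linarith) (by linarith), mul_div_assoc',
        div_le_div_iff₀ (by positivity) (by nlinarith)]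
      nlinarith [mul_nonneg h' (by linarith : 0 ≤ -v), mul_nonneg (mul_nonneg h' (by linarith : 0 ≤ -v)) (sq_nonneg v), sq_nonneg v]
    · rw [abs_of_neg h, abs_of_neg h', div_sub_div _ _ (by linarith) (by linarith), mul_div_assoc',
        div_le_div_iff₀ (by positivity) (by nlinarith)]
      nlinarith [sq_nonneg (v + 1)]

theorem sum_inv_sq_add_one_le (u : ℝ) (n : ℕ) :
    ∑ j ∈ Finset.Icc 1 n, 1 / ((u + j) ^ 2 + 1) ≤ 8 := by
  have hg : ∀ v : ℝ, |v / (1 + |v|)| ≤ 1 := fun v => by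
    rw [abs_div, abs_of_pos (by positivity : 0 < 1 + |v|), div_le_one (by positivity)]
    linarith
  have h : ∀ n : ℕ, ∑ j ∈ Finset.Icc 1 n, 1 / ((u + j) ^ 2 + 1) ≤
      4 * ((u + n + 1) / (1 + |u + n + 1|) - (u + 1) / (1 + |u + 1|)) := by
    intro n
    induction n with
    | zero => simp
    | succ n ih =>
      rw [Finset.sum_Icc_succ_top (by omega)]
      have := inv_sq_add_one_le (u + n + 1)
      push_cast at *
      rw [← add_assoc]
      linarith
  have h1 := (abs_le.1 (hg (u + n + 1))).2
  have h2 := (abs_le.1 (hg (u + 1))).1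
  linarith [h n]

/-- Dividing `H` by its step `q^2` turns the main term into `60K (Q^2 / q^2) / (v^2 + 1)` with `v`
running in unit steps. The factor `Q / q` that a termwise bound over all `B` would lose is thereby
saved. -/
theorem sum_halfWidth_le {K Q q h : ℤ} (hK : 0 ≤ K) (hq : 1 ≤ q) (n : ℕ) :
    ∑ j ∈ Finset.Icc 1 n, (halfWidth K Q q (h + q ^ 2 * (j : ℤ)) : ℝ) ≤
      480 * K * (Q ^ 2 / q ^ 2) + 3 * n := by
  have hqr : (1 : ℝ) ≤ q := by exact_mod_cast hq
  have hKr : (0 : ℝ) ≤ K := by exact_mod_cast hK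
  calc ∑ j ∈ Finset.Icc 1 n, (halfWidth K Q q (h + q ^ 2 * (j : ℤ)) : ℝ)
      ≤ ∑ j ∈ Finset.Icc 1 n, (60 * K * (Q ^ 2 / q ^ 2) * (1 / (((h : ℝ) / q ^ 2 + j) ^ 2 + 1)) + 3) := by
        refine Finset.sum_le_sum fun j _ => (halfWidth_le hq).trans (le_of_eq ?_)
        push_cast
        have : ((h : ℝ) + q ^ 2 * j) ^ 2 + q ^ 4 = q ^ 4 * (((h : ℝ) / q ^ 2 + j) ^ 2 + 1) := by
          field_simp
        rw [this]
        field_simp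
    _ ≤ _ := by
        rw [Finset.sum_add_distrib, ← Finset.mul_sum]
        simp only [Finset.sum_const, Nat.card_Icc, add_tsub_cancel_right, nsmul_eq_mul]
        have := mul_le_mul_of_nonneg_left (sum_inv_sq_add_one_le ((h : ℝ) / q ^ 2) n)
          (by positivity : 0 ≤ 60 * (K : ℝ) * (Q ^ 2 / q ^ 2))
        linarith

/-! ### Farey fractions -/

/-- The reduced fractions in `[0, 1)` with denominator at most `Q` that are at least `p / q`. -/
noncomputable def fareyFrom (Q p q : ℤ) : Finset (ℤ × ℤ) :=
  {v ∈ Finset.Icc 0 Q ×ˢ Finset.Icc 1 Q | v.1 < v.2 ∧ IsCoprime v.1 v.2 ∧ p * v.2 ≤ v.1 * q}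

theorem mem_fareyFrom {Q p q : ℤ} {v : ℤ × ℤ} : v ∈ fareyFrom Q p q ↔
    0 ≤ v.1 ∧ v.1 < v.2 ∧ v.2 ≤ Q ∧ IsCoprime v.1 v.2 ∧ p * v.2 ≤ v.1 * q := by
  simp only [fareyFrom, Finset.mem_filter, Finset.mem_product, Finset.mem_Icc]
  constructor
  · rintro ⟨⟨⟨h1, _⟩, _, h2⟩, h3, h4, h5⟩
    exact ⟨h1, h3, h2, h4, h5⟩
  · rintro ⟨h1, h2, h3, h4, h5⟩
    exact ⟨⟨⟨h1, by omega⟩, by omega, h3⟩, h2, h4, h5⟩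

/-- Consecutive fractions `p / q < r / s` of level `Q`. -/
structure FareyPair (Q p q r s : ℤ) : Prop where
  det : r * q - p * s = 1
  p_nonneg : 0 ≤ p
  r_nonneg : 0 ≤ r
  one_le_q : 1 ≤ q
  one_le_s : 1 ≤ s
  q_le : q ≤ Q
  s_le : s ≤ Q
  lt_add : Q < q + s

theorem FareyPair.r_le {Q p q r s : ℤ} (h : FareyPair Q p q r s) (hpq : p < q) : r ≤ s := by
  obtain ⟨h1, h2, h3, h4, h5, h6, h7, h8⟩ := h
  have : q * r ≤ q * s := by nlinarith
  exact le_of_mul_le_mul_left this (by omega)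

theorem FareyPair.r_le' {Q p q r s : ℤ} (h : FareyPair Q p q r s) (hpq : p ≤ q) : r ≤ s + 1 := by
  obtain ⟨h1, h2, h3, h4, h5, h6, h7, h8⟩ := h
  have : q * r ≤ q * (s + 1) := by nlinarith
  exact le_of_mul_le_mul_left this (by omega)

/-- The classical recurrence: `k = (Q + q) / s` is the largest multiplier with `k s - q ≤ Q`, and
the determinant is preserved for any multiplier. -/
theorem FareyPair.next {Q p q r s : ℤ} (h : FareyPair Q p q r s) :
    FareyPair Q r s ((Q + q) / s * r - p) ((Q + q) / s * s - q) := by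
  obtain ⟨h1, h2, h3, h4, h5, h6, h7, h8⟩ := h
  obtain ⟨k1, k2⟩ := ediv_mul_bounds (Q + q) (by omega : 0 < s)
  generalize (Q + q) / s = k at *
  have e1 : (k * r - p) * s - r * (k * s - q) = 1 := by linear_combination h1
  have e2 : 1 ≤ k * s - q := by linarith
  refine ⟨e1, h3, ?_, h5, e2, h7, by linarith, by linarith⟩
  by_contra hneg
  nlinarith [mul_nonneg h3 (by omega : 0 ≤ k * s - q)]

theorem FareyPair.fareyFrom_eq {Q p q r s : ℤ} (h : FareyPair Q p q r s) (hpq : p < q) :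
    fareyFrom Q p q = insert (p, q) (fareyFrom Q r s) := by
  obtain ⟨h1, h2, h3, h4, h5, h6, h7, h8⟩ := h
  ext ⟨a, b⟩
  simp only [Finset.mem_insert, mem_fareyFrom, Prod.mk.injEq]
  constructor
  · rintro ⟨k1, k2, k3, k4, k5⟩
    -- Expand `(a, b)` in the unimodular basis `(p, q)`, `(r, s)`. If both coefficients are
    -- positive, then `b ≥ q + s > Q`, so nothing lies strictly between the two fractions.
    have eb : b = q * (r * b - a * s) + s * (a * q - p * b) := by linear_combination (-b) * h1
    have ea : a = p * (r * b - a * s) + r * (a * q - p * b) := by linear_combination (-a) * h1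
    rcases k5.lt_or_eq with k5 | k5
    · right
      refine ⟨k1, k2, k3, k4, ?_⟩
      by_contra hlt
      have : q * 1 ≤ q * (r * b - a * s) := by gcongr; omega
      have : s * 1 ≤ s * (a * q - p * b) := by gcongr; omega
      linarith
    · left
      rw [k5, sub_self, mul_zero, add_zero] at ea eb
      have hu : IsUnit (r * b - a * s) := k4.isUnit_of_dvd' ⟨p, by linarith⟩ ⟨q, by linarith⟩
      rcases Int.isUnit_iff.1 hu with hu | hu
      · rw [hu] at ea eb; omega
      · rw [hu] at ea eb; omega
  · rintro (⟨rfl, rfl⟩ | ⟨k1, k2, k3, k4, k5⟩)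
    · exact ⟨h2, hpq, h6, ⟨-s, r, by linarith⟩, le_rfl⟩
    · refine ⟨k1, k2, k3, k4, ?_⟩
      have : s * (p * b) ≤ s * (a * q) := by
        have : r * b * q ≤ a * s * q := by gcongr
        nlinarith
      exact le_of_mul_le_mul_left this (by omega)

theorem FareyPair.notMem {Q p q r s : ℤ} (h : FareyPair Q p q r s) :
    (p, q) ∉ fareyFrom Q r s := by
  rw [mem_fareyFrom]
  rintro ⟨-, -, -, -, k⟩
  linarith [h.det]

theorem fareyFrom_eq_empty {Q p q : ℤ} (hq : 1 ≤ q) (h : q ≤ p) : fareyFrom Q p q = ∅ := by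
  refine Finset.eq_empty_of_forall_notMem fun v hv => ?_
  obtain ⟨k1, k2, k3, k4, k5⟩ := mem_fareyFrom.1 hv
  nlinarith

/-- A denominator `b` carries at most `b` numerators, so the sum is at most `Q^2` times a harmonic
sum. This is the source of the single logarithm in the number of candidates. -/
theorem sum_fareyFrom_le (Q : ℕ) :
    ∑ v ∈ fareyFrom Q 0 1, (Q : ℝ) ^ 2 / (v.2 : ℝ) ^ 2 ≤ (Q : ℝ) ^ 2 * (1 + Real.log Q) := by
  have h1 : ∀ v ∈ fareyFrom Q 0 1, v.2 ∈ Finset.Icc (1 : ℤ) Q := fun v hv => by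
    obtain ⟨k1, k2, k3, -⟩ := mem_fareyFrom.1 hv
    exact Finset.mem_Icc.2 ⟨by omega, k3⟩
  rw [← Finset.sum_fiberwise_of_maps_to h1]
  calc ∑ b ∈ Finset.Icc (1 : ℤ) Q, ∑ v ∈ fareyFrom Q 0 1 with v.2 = b, (Q : ℝ) ^ 2 / (v.2 : ℝ) ^ 2
      ≤ ∑ b ∈ Finset.Icc (1 : ℤ) Q, (Q : ℝ) ^ 2 * (b : ℝ)⁻¹ := by
        refine Finset.sum_le_sum fun b hb => ?_
        have hb1 : 1 ≤ b := (Finset.mem_Icc.1 hb).1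
        have hbr : (1 : ℝ) ≤ b := by exact_mod_cast hb1
        rw [Finset.sum_congr rfl (g := fun _ => (Q : ℝ) ^ 2 / (b : ℝ) ^ 2)
          (fun v hv => by rw [(Finset.mem_filter.1 hv).2]), Finset.sum_const, nsmul_eq_mul]
        have hcard : Finset.card {v ∈ fareyFrom Q 0 1 | v.2 = b} ≤ b.toNat := by
          have : b.toNat = (Finset.Ico (0 : ℤ) b).card := by simp
          rw [this]
          refine Finset.card_le_card_of_injOn Prod.fst ?_ ?_
          · intro v hv
            obtain ⟨hv, hb⟩ := Finset.mem_filter.1 (Finset.mem_coe.1 hv)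
            obtain ⟨k1, k2, -⟩ := mem_fareyFrom.1 hv
            exact Finset.mem_coe.2 (Finset.mem_Ico.2 ⟨k1, hb ▸ k2⟩)
          · intro v hv w hw e
            have hv' := (Finset.mem_filter.1 (Finset.mem_coe.1 hv)).2
            have hw' := (Finset.mem_filter.1 (Finset.mem_coe.1 hw)).2
            exact Prod.ext e (hv'.trans hw'.symm)
        have hcard' : ((Finset.card {v ∈ fareyFrom Q 0 1 | v.2 = b} : ℕ) : ℝ) ≤ b := by
          have : ((Finset.card {v ∈ fareyFrom Q 0 1 | v.2 = b} : ℕ) : ℤ) ≤ b := by omega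
          exact_mod_cast this
        calc _ ≤ (b : ℝ) * ((Q : ℝ) ^ 2 / (b : ℝ) ^ 2) := by gcongr
          _ = _ := by field_simp
    _ = (Q : ℝ) ^ 2 * (harmonic Q : ℝ) := by
        rw [← Finset.mul_sum, harmonic_eq_sum_Icc]
        have : Finset.Icc (1 : ℤ) Q = (Finset.Icc 1 Q).map Nat.castEmbedding := by
          ext x
          simp only [Finset.mem_Icc, Finset.mem_map, Nat.castEmbedding_apply]
          constructor
          · rintro ⟨h1, h2⟩; exact ⟨x.toNat, by omega, by omega⟩
          · rintro ⟨y, h, rfl⟩; omega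
        rw [this, Finset.sum_map]
        push_cast
        rfl
    _ ≤ _ := by gcongr; exact harmonic_le_one_add_log Q

/-! ### The search program -/

instance : Add Expr := ⟨.add⟩
instance : Sub Expr := ⟨.sub⟩
instance : Mul Expr := ⟨.mul⟩
instance : Div Expr := ⟨.div⟩

section
variable (s : State) (e f : Expr) (M : ℕ)

@[simp] theorem Expr.eval_add : (e + f).eval s = e.eval s + f.eval s := rfl
@[simp] theorem Expr.eval_sub : (e - f).eval s = e.eval s - f.eval s := rfl
@[simp] theorem Expr.eval_mul : (e * f).eval s = e.eval s * f.eval s := rfl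
@[simp] theorem Expr.eval_div : (e / f).eval s = e.eval s / f.eval s := rfl
@[simp] theorem Expr.eval_const (n : ℤ) : (Expr.const n).eval s = n := rfl
@[simp] theorem Expr.eval_reg (i : ℕ) : (Expr.reg i).eval s = s i := rfl
@[simp] theorem Expr.constLE_add : (e + f).ConstLE M ↔ e.ConstLE M ∧ f.ConstLE M := Iff.rfl
@[simp] theorem Expr.constLE_sub : (e - f).ConstLE M ↔ e.ConstLE M ∧ f.ConstLE M := Iff.rfl
@[simp] theorem Expr.constLE_mul : (e * f).ConstLE M ↔ e.ConstLE M ∧ f.ConstLE M := Iff.rfl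
@[simp] theorem Expr.constLE_div : (e / f).ConstLE M ↔ e.ConstLE M ∧ f.ConstLE M := Iff.rfl
@[simp] theorem Expr.constLE_const (n : ℤ) : (Expr.const n).ConstLE M ↔ n.natAbs ≤ M := Iff.rfl
@[simp] theorem Expr.constLE_reg (i : ℕ) : (Expr.reg i).ConstLE M ↔ True := Iff.rfl

end

/-- Repeat `P` with the register `i` as a counter. -/
def Prog.loop (i : ℕ) (P : Prog) : Prog :=
  .whilePos (.reg i) (.seq P (.assign i (.sub (.reg i) (.const 1))))

open BitCost.Expr BitCost.Prog

/-- The first coordinate, from its counter. -/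
def firstCoordExpr (c : ℕ) : Expr :=
  reg 6 - reg 2 * reg 2 * reg 2 / reg 3 - const (15 + 2 * c)
/-- The value of the cubic form at the fraction. -/
def discExpr : Expr := reg 2 * reg 2 * reg 2 + reg 3 * reg 7
/-- The number of second coordinates. -/
def secondCountExpr : Expr := const 2 * (const 27 * reg 1 / reg 3 + const 3)
/-- The second coordinate, from its counter. -/
def secondCoordExpr : Expr :=
  (const 2 * reg 3 * reg 5 * reg 7 - const 3 * reg 2 * reg 2) / (reg 3 * reg 3) -
    (const 27 * reg 1 / reg 3 + const 3) + reg 9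
/-- The derivative of the cubic form at the fraction. -/
def slopeExpr : Expr :=
  const 3 * reg 2 * reg 2 + reg 3 * (reg 3 * reg 10 - const 2 * reg 5 * reg 7)
/-- The half-width of the last window. -/
def widthExpr (c : ℕ) : Expr :=
  const (60 * (51 + 48 * c)) * reg 1 * reg 1 * reg 3 * reg 3 /
    (reg 11 * reg 11 + reg 3 * reg 3 * reg 3 * reg 3) + const 3
/-- Positive if the derivative is large. -/
def largeExpr (c : ℕ) : Expr :=
  reg 11 * reg 11 - const (2 * (51 + 48 * c)) * reg 3 * reg 3 * reg 3 * reg 3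
/-- The centre of the last window for a large derivative. -/
def centreExpr : Expr := reg 11 * reg 11 / (const 4 * reg 8)
/-- The residue of the root modulo the cube of the denominator. -/
def offsetExpr : Expr :=
  const 3 * reg 2 + reg 3 * reg 5 * (reg 7 * reg 5 - reg 10 * reg 3)
/-- The last coordinate before the first one of its window. -/
def startExpr : Expr := (reg 18 - offsetExpr) / (reg 3 * reg 3 * reg 3) - reg 12 - const 1
/-- The number of last coordinates. -/
def thirdCountExpr : Expr := const 2 * reg 12 + const 1
/-- Three times the numerator of the approximate root. -/
def rootExpr : Expr := offsetExpr + reg 3 * reg 3 * reg 3 * (reg 13 + reg 14)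
/-- The first component of the candidate. -/
def xExpr : Expr := (reg 15 * reg 15 - const 3 * reg 11) / (const 9 * reg 3 * reg 3)
/-- The second component of the candidate. -/
def yExpr : Expr :=
  (const 27 * reg 8 - reg 15 * reg 15 * reg 15 + const 27 * reg 16 * reg 3 * reg 3 * reg 15) /
    (const 54 * reg 3 * reg 3 * reg 3)

/-- Compute a candidate and pass it on to the filter `E`. -/
def candidateProg (E : Prog) : Prog :=
  .seq (.assign 15 rootExpr) (.seq (.assign 16 xExpr) (.seq (.assign 17 yExpr) E))

/-- Run through the last coordinate. -/
def thirdProg (c : ℕ) (E : Prog) : Prog :=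
  .seq (.assign 10 secondCoordExpr) (.seq (.assign 11 slopeExpr) (.seq (.assign 12 (widthExpr c))
    (.seq (.ifPos (largeExpr c) (.assign 18 centreExpr) (.assign 18 (const 0)))
      (.seq (.assign 13 startExpr) (.seq (.assign 14 thirdCountExpr)
        (loop 14 (candidateProg E)))))))

/-- Run through the last two coordinates. -/
def secondProg (c : ℕ) (E : Prog) : Prog :=
  .seq (.assign 7 (firstCoordExpr c)) (.seq (.assign 8 discExpr)
    (.seq (.assign 9 secondCountExpr) (loop 9 (thirdProg c E))))

/-- Go to the next Farey fraction. -/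
def nextProg : Prog :=
  .seq (.assign 13 ((reg 1 + reg 3) / reg 5)) (.seq (.assign 16 (reg 13 * reg 4 - reg 2))
    (.seq (.assign 17 (reg 13 * reg 5 - reg 3)) (.seq (.assign 2 (reg 4)) (.seq (.assign 3 (reg 5))
      (.seq (.assign 4 (reg 16)) (.seq (.assign 5 (reg 17)) .skip))))))

/-- Treat one Farey fraction. -/
def fractionProg (c : ℕ) (E : Prog) : Prog :=
  .seq (.assign 6 (const (29 + 4 * c))) (.seq (loop 6 (secondProg c E)) nextProg)

/-- Treat one scale. -/
def scaleProg (c : ℕ) (E : Prog) : Prog :=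
  .seq (.assign 2 (const 0)) (.seq (.assign 3 (const 1)) (.seq (.assign 4 (const 1))
    (.seq (.assign 5 (reg 1)) (.seq (.whilePos (reg 3 - reg 2) (fractionProg c E))
      (.seq (.assign 1 (reg 1 + reg 1)) .skip)))))

/-- The search program. -/
def searchProg (c N : ℕ) (E : Prog) : Prog :=
  .seq (.assign 1 (const 1)) (.whilePos
    (const N * reg 0 - reg 1 * reg 1 * reg 1 * reg 1 + const 1) (scaleProg c E))

/-! ### The three nested loops over the coordinates -/

/-- The pair `v`, rescaled by `N` and `N'`, is the candidate belonging to `q, H, d, Z`. -/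
def Hits (N N' : ℕ) (q H d Z : ℤ) (v : ℤ × ℤ) : Prop :=
  N * v.1 = (Z * Z - 3 * H) / (9 * q * q) ∧
    |N' * v.2| = (27 * d - Z * Z * Z + 27 * (N * v.1) * q * q * Z) / (54 * q * q * q)

/-- What a filter `E` has to do: read the candidate in registers `16` and `17`, write only pairs in
`S`, and write the pairs of `T` that belong to the candidate. -/
def FilterSpec (M X N N' : ℕ) (S T : Set (ℤ × ℤ)) (E : Prog) (w : ℝ) : Prop :=
  ∀ s : State, Bounded M s → s 0 = X →
    Spec M S E s w {v ∈ T | N * v.1 = s 16 ∧ |N' * v.2| = s 17} (fun s' => s' = s)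

noncomputable def candidateWork (w : ℝ) : ℝ :=
  rootExpr.coef + 2 + (xExpr.coef + 2 + (yExpr.coef + 2 + w))

variable {M X N N' c : ℕ} {S T : Set (ℤ × ℤ)} {E : Prog} {w : ℝ}

/-- The numbers `44 = 3 * 8 + 20` and `11 = 8 + 3` are the overhead of `Spec.forLoop` for register
`14`, whose exponent is `8`. -/
theorem candidate_spec (hM : 60 * (51 + 48 * c) ≤ M) (hE : FilterSpec M X N N' S T E w)
    {n : ℕ} {s : State} (hs : Bounded M s) (h0 : s 0 = X) (h14 : s 14 = n) :
    Spec M S (loop 14 (candidateProg E)) s (n * (candidateWork w + 44) + 11)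
      {v ∈ T | ∃ A, s 13 + 1 ≤ A ∧ A ≤ s 13 + n ∧ Hits N N' (s 3) (s 11) (s 8)
        (3 * s 2 + s 3 * s 5 * (s 7 * s 5 - s 10 * s 3) + s 3 * s 3 * s 3 * A) v}
      (fun s' => Bounded M s' ∧ ∀ i, i < 14 → s' i = s i) := by
  have hM2 : 2 ≤ M := by omega
  refine (Spec.forLoop hM2 (i := 14) (P := candidateProg E)
    (I := fun s' => Bounded M s' ∧ ∀ i, i < 14 → s' i = s i)
    (W := fun _ => candidateWork w)
    (D := fun j => {v ∈ T | Hits N N' (s 3) (s 11) (s 8)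
        (3 * s 2 + s 3 * s 5 * (s 7 * s 5 - s 10 * s 3) + s 3 * s 3 * s 3 * (s 13 + j)) v})
    (fun _ h => h.1) ?_ ?_ n s h14 ⟨hs, fun _ _ => rfl⟩).mono ?_ ?_ ?_
  · rintro j t - h14 ⟨hb, hf⟩
    refine Spec.assign_seq hM2 hb ?_ (natAbs_eval_le_regDeg hM2 hb ?_ (by decide)) fun t1 hb1 e1 f1 => ?_
    iterate 2 simp [rootExpr, offsetExpr]; omega
    refine Spec.assign_seq hM2 hb1 ?_ (natAbs_eval_le_regDeg hM2 hb1 ?_ (by decide)) fun t2 hb2 e2 f2 => ?_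
    iterate 2 simp [xExpr]; omega
    refine Spec.assign_seq hM2 hb2 ?_ (natAbs_eval_le_regDeg hM2 hb2 ?_ (by decide)) fun t3 hb3 e3 f3 => ?_
    iterate 2 simp [yExpr]; omega
    have g : ∀ i, i < 15 → t3 i = t i := fun i hi => by
      rw [f3 i (by omega), f2 i (by omega), f1 i (by omega)]
    refine (hE t3 hb3 (by rw [g 0 (by norm_num), hf 0 (by norm_num), h0])).mono le_rfl ?_ ?_
    · rintro v ⟨hv, h1, h2⟩
      refine ⟨hv, ?_, ?_⟩
      · rw [f3 16 (by norm_num), e2]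
        simp only [xExpr, eval_sub, eval_mul, eval_div, eval_const, eval_reg]
        rw [f1 11 (by norm_num), f1 3 (by norm_num), e1]
        simp only [rootExpr, offsetExpr, eval_add, eval_sub, eval_mul, eval_const, eval_reg]
        rw [h14]
        simpa [hf] using h1
      · rw [e3]
        simp only [yExpr, eval_add, eval_sub, eval_mul, eval_div, eval_const, eval_reg]
        have h16 : t2 16 = N * v.1 := by
          rw [e2, h1]
          simp only [xExpr, eval_sub, eval_mul, eval_div, eval_const, eval_reg]
          rw [f1 11 (by norm_num), f1 3 (by norm_num), e1]
          simp only [rootExpr, offsetExpr, eval_add, eval_sub, eval_mul, eval_const, eval_reg]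
          rw [h14]
          simp [hf]
        rw [h16, f2 15 (by norm_num), f2 3 (by norm_num), f2 8 (by norm_num), f1 3 (by norm_num),
          f1 8 (by norm_num), e1]
        simp only [rootExpr, offsetExpr, eval_add, eval_sub, eval_mul, eval_const, eval_reg]
        rw [h14]
        simpa [hf] using h2
    · rintro _ rfl
      exact ⟨⟨hb3, fun i hi => by rw [g i (by omega), hf i hi]⟩, by rw [g 14 (by norm_num), h14]⟩
  · rintro t ⟨hb, hf⟩ h
    refine ⟨hb.dec h, fun i hi => ?_⟩
    rw [Function.update_of_ne (by omega), hf i hi]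
  · simp [regDeg]
    linarith
  · rintro v ⟨hv, A, h1, h2, h3⟩
    simp only [Set.mem_iUnion, Finset.mem_Icc]
    refine ⟨(A - s 13).toNat, ⟨by omega, by omega⟩, hv, ?_⟩
    have : s 13 + ((A - s 13).toNat : ℤ) = A := by omega
    rwa [this]
  · exact fun _ h => h

/-- The pair `v` is found from the second and third coordinates `B`, `A` in their windows. -/
def HitsThird (c N N' : ℕ) (Q p q s C d B : ℤ) (v : ℤ × ℤ) : Prop :=
  ∃ A H Z : ℤ, H = 3 * p * p + q * (q * B - 2 * s * C) ∧
    Z = 3 * p + q * s * (C * s - B * q) + q * q * q * A ∧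
    |A - (centre (51 + 48 * c) q d H - (3 * p + q * s * (C * s - B * q))) / (q * q * q)| ≤
      halfWidth (51 + 48 * c) Q q H ∧ Hits N N' q H d Z v

noncomputable def thirdOverhead (c : ℕ) (w : ℝ) : ℝ :=
  secondCoordExpr.coef + slopeExpr.coef + (widthExpr c).coef + (largeExpr c).coef +
    centreExpr.coef + startExpr.coef + thirdCountExpr.coef + candidateWork w + 80

/-- The window is computed from the registers alone, so the bound for the work holds for every
choice of the first two coordinates, whether or not a pair of `T` belongs to it. -/
theorem third_spec (hM : 60 * (51 + 48 * c) ≤ M) (hE : FilterSpec M X N N' S T E w)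
    {s : State} (hs : Bounded M s) (h0 : s 0 = X) :
    Spec M S (thirdProg c E) s
      (2 * (candidateWork w + 44) * (halfWidth (51 + 48 * c) (s 1) (s 3) (3 * s 2 * s 2 +
        s 3 * (s 3 * ((2 * s 3 * s 5 * s 7 - 3 * s 2 * s 2) / (s 3 * s 3) -
          (27 * s 1 / s 3 + 3) + s 9) - 2 * s 5 * s 7)) : ℤ) + thirdOverhead c w)
      {v ∈ T | HitsThird c N N' (s 1) (s 2) (s 3) (s 5) (s 7) (s 8)
        ((2 * s 3 * s 5 * s 7 - 3 * s 2 * s 2) / (s 3 * s 3) - (27 * s 1 / s 3 + 3) + s 9) v}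
      (fun s' => Bounded M s' ∧ ∀ i, i < 10 → s' i = s i) := by
  have hM2 : 2 ≤ M := by omega
  generalize hB : (2 * s 3 * s 5 * s 7 - 3 * s 2 * s 2) / (s 3 * s 3) -
    (27 * s 1 / s 3 + 3) + s 9 = B
  generalize hH : 3 * s 2 * s 2 + s 3 * (s 3 * B - 2 * s 5 * s 7) = H
  have hV3 := three_le_halfWidth (K := 51 + 48 * c) (Q := s 1) (q := s 3) (H := H) (by positivity)
  generalize hV : halfWidth (51 + 48 * c) (s 1) (s 3) H = V at hV3
  unfold thirdProg
  refine Spec.mono (W := secondCoordExpr.coef + 2 + (slopeExpr.coef + 2 + ((widthExpr c).coef + 2 +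
    ((largeExpr c).coef + 1 + (centreExpr.coef + 4) + (startExpr.coef + 2 +
      (thirdCountExpr.coef + 2 + ((2 * V + 1).toNat * (candidateWork w + 44) + 11))) + 1))))
    (D := {v ∈ T | HitsThird c N N' (s 1) (s 2) (s 3) (s 5) (s 7) (s 8) B v})
    (R := fun s' => Bounded M s' ∧ ∀ i, i < 10 → s' i = s i) ?_ ?_ le_rfl (fun _ h => h)
  · refine Spec.assign_seq hM2 hs ?_ (natAbs_eval_le_regDeg hM2 hs ?_ (by decide))
      fun s1 b1 e1 f1 => ?_
    iterate 2 simp [secondCoordExpr]; omega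
    refine Spec.assign_seq hM2 b1 ?_ (natAbs_eval_le_regDeg hM2 b1 ?_ (by decide))
      fun s2 b2 e2 f2 => ?_
    iterate 2 simp [slopeExpr]; omega
    refine Spec.assign_seq hM2 b2 ?_ (natAbs_eval_le_regDeg hM2 b2 ?_ (Nat.le_of_ble_eq_true rfl))
      fun s3 b3 e3 f3 => ?_
    iterate 2 simp [widthExpr]; omega
    have g3 : ∀ i, i < 10 → s3 i = s i := fun i hi => by
      rw [f3 i (by omega), f2 i (by omega), f1 i (by omega)]
    have r10 : s3 10 = B := by
      rw [f3 10 (by norm_num), f2 10 (by norm_num), e1]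
      simpa [secondCoordExpr] using hB
    have r11 : s3 11 = H := by
      rw [f3 11 (by norm_num), e2, ← hH, ← r10, f3 10 (by norm_num), f2 10 (by norm_num)]
      simp [slopeExpr, f1]
    have r12 : s3 12 = V := by
      rw [e3, ← hV, halfWidth]
      have e4 : s2 11 = H := by rw [← r11, f3 11 (by norm_num)]
      have e5 : s2 1 = s 1 := by rw [← g3 1 (by norm_num), f3 1 (by norm_num)]
      have e6 : s2 3 = s 3 := by rw [← g3 3 (by norm_num), f3 3 (by norm_num)]
      simp only [widthExpr, eval_add, eval_mul, eval_div, eval_const, eval_reg, e4, e5, e6]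
      ring_nf
    rw [← Set.empty_union {v ∈ T | HitsThird c N N' (s 1) (s 2) (s 3) (s 5) (s 7) (s 8) B v}]
    refine Spec.seq hM2 (R := fun s' => Bounded M s' ∧ s' 18 = centre (51 + 48 * c) (s 3) (s 8) H ∧
      ∀ i, i ≠ 18 → s' i = s3 i) (Spec.ifPos hM2 b3 ?_ (fun hp => ?_) (fun hp => ?_)) ?_
    · simp [largeExpr]; omega
    -- Here `d` may be zero or negative. The centre is then useless but harmless: `third_window`
    -- shows that no near-solution has such a `d` when `H` is large.
    · have hc : centreExpr.ConstLE M := by simp [centreExpr]; omega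
      refine (Spec.assign hM2 b3 hc).mono (by linarith) le_rfl ?_
      rintro _ rfl
      refine ⟨b3.update (natAbs_eval_le_regDeg hM2 b3 hc (by decide)), ?_, fun i hi => by simp [hi]⟩
      have hp' : 0 < H ^ 2 - 2 * (51 + 48 * c) * s 3 ^ 4 := by
        have h := hp
        simp only [largeExpr, eval_sub, eval_mul, eval_const, eval_reg, r11,
          g3 3 (by norm_num)] at h
        refine h.trans_eq ?_
        ring
      rw [centre, if_pos hp']
      simp only [Function.update_self, centreExpr, eval_mul, eval_div, eval_const, eval_reg, r11,
          g3 8 (by norm_num), pow_two]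
    · refine (Spec.assign hM2 b3 (e := const 0) (by simp)).mono ?_ le_rfl ?_
      · have : (0 : ℝ) ≤ centreExpr.coef := by positivity
        simp only [Expr.coef]
        push_cast; linarith
      rintro _ rfl
      refine ⟨b3.update (by simp), ?_, fun i hi => by simp [hi]⟩
      have hp' : ¬ 0 < H ^ 2 - 2 * (51 + 48 * c) * s 3 ^ 4 := by
        have h := hp
        simp only [largeExpr, eval_sub, eval_mul, eval_const, eval_reg, r11,
          g3 3 (by norm_num)] at h
        rw [not_lt]
        refine Eq.trans_le ?_ h
        ring
      rw [centre, if_neg hp']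
      simp
    rintro s4 ⟨b4, r18, f4⟩
    refine Spec.assign_seq hM2 b4 ?_ (natAbs_eval_le_regDeg hM2 b4 ?_ (by decide))
      fun s5 b5 e5 f5 => ?_
    iterate 2 simp [startExpr, offsetExpr]; omega
    refine Spec.assign_seq hM2 b5 ?_ (natAbs_eval_le_regDeg hM2 b5 ?_ (by decide))
      fun s6 b6 e6 f6 => ?_
    iterate 2 simp [thirdCountExpr]; omega
    have g6 : ∀ i, i < 13 → s6 i = s3 i := fun i hi => by
      rw [f6 i (by omega), f5 i (by omega), f4 i (by omega)]
    have g : ∀ i, i < 10 → s6 i = s i := fun i hi => by rw [g6 i (by omega), g3 i hi]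
    have r14 : s6 14 = ((2 * V + 1).toNat : ℤ) := by
      rw [e6]
      simp only [thirdCountExpr, eval_add, eval_mul, eval_const, eval_reg]
      rw [f5 12 (by norm_num), f4 12 (by norm_num), r12]
      omega
    have r13 : s6 13 = (centre (51 + 48 * c) (s 3) (s 8) H -
        (3 * s 2 + s 3 * s 5 * (s 7 * s 5 - B * s 3))) / (s 3 * s 3 * s 3) - V - 1 := by
      rw [f6 13 (by norm_num), e5]
      simp [startExpr, offsetExpr, r18, f4, g3, r10, r12]
    refine (candidate_spec hM hE b6 (by rw [g 0 (by norm_num), h0]) r14).mono le_rfl ?_ ?_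
    · rintro v ⟨hv, A, _, _, rfl, rfl, hA, hh⟩
      refine ⟨hv, A, ?_, ?_, ?_⟩
      · rw [hH, hV] at hA
        rw [r13]
        linarith [(abs_le.1 hA).1]
      · rw [hH, hV] at hA
        rw [r13]
        have := (abs_le.1 hA).2
        omega
      · rw [hH] at hh
        rw [g 3 (by norm_num), g 8 (by norm_num), g 2 (by norm_num), g 5 (by norm_num),
          g 7 (by norm_num), g6 10 (by norm_num), g6 11 (by norm_num), r10, r11]
        exact hh
    · rintro s' ⟨b', f'⟩
      exact ⟨b', fun i hi => by rw [f' i (by omega), g i hi]⟩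
  · have : (((2 * V + 1).toNat : ℕ) : ℝ) = 2 * V + 1 := by
      have : (((2 * V + 1).toNat : ℕ) : ℤ) = 2 * V + 1 := by omega
      exact_mod_cast this
    rw [this, thirdOverhead]
    linarith

/-- The constants combine `sum_halfWidth_le` with `second_count_le`: at most `60 Q^2 / q^2` turns,
hence `180 = 3 * 60`. The terms `32` and `7` are the overhead of `Spec.forLoop` for register `9`,
with exponent `4`. -/
noncomputable def secondWork (c : ℕ) (w : ℝ) : ℝ :=
  2 * (candidateWork w + 44) * (480 * (51 + 48 * c) + 180) + 60 * (thirdOverhead c w + 32) + 7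

/-- The pair `v` is found from the second coordinate in its window. -/
def HitsSecond (c N N' : ℕ) (Q p q s C d : ℤ) (v : ℤ × ℤ) : Prop :=
  ∃ B : ℤ, 1 ≤ B - ((2 * q * s * C - 3 * p * p) / (q * q) - (27 * Q / q + 3)) ∧
    B - ((2 * q * s * C - 3 * p * p) / (q * q) - (27 * Q / q + 3)) ≤ 2 * (27 * Q / q + 3) ∧
    HitsThird c N N' Q p q s C d B v

theorem candidateWork_nonneg (hw : 0 ≤ w) : 0 ≤ candidateWork w := by
  unfold candidateWork; positivity

theorem thirdOverhead_nonneg (hw : 0 ≤ w) : 0 ≤ thirdOverhead c w := by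
  have := candidateWork_nonneg hw
  unfold thirdOverhead; positivity

theorem secondWork_nonneg (hw : 0 ≤ w) : 0 ≤ secondWork c w := by
  have := candidateWork_nonneg hw
  have := thirdOverhead_nonneg (c := c) hw
  unfold secondWork; positivity

theorem one_le_ratio {Q q : ℤ} (hq : 1 ≤ q) (hqQ : q ≤ Q) : (1 : ℝ) ≤ (Q : ℝ) ^ 2 / (q : ℝ) ^ 2 := by
  have h1 : (1 : ℝ) ≤ q := by exact_mod_cast hq
  have h2 : (q : ℝ) ≤ Q := by exact_mod_cast hqQ
  rw [one_le_div (by positivity)]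
  gcongr

theorem second_count_le {Q q : ℤ} (hq : 1 ≤ q) (hqQ : q ≤ Q) :
    ((2 * (27 * Q / q + 3)).toNat : ℝ) ≤ 60 * ((Q : ℝ) ^ 2 / (q : ℝ) ^ 2) := by
  have h0 : 0 ≤ 27 * Q / q := Int.ediv_nonneg (by omega) (by omega)
  have h1 : (1 : ℝ) ≤ q := by exact_mod_cast hq
  have h2 : (q : ℝ) ≤ Q := by exact_mod_cast hqQ
  have h3 : ((2 * (27 * Q / q + 3)).toNat : ℝ) = 2 * (((27 * Q / q : ℤ) : ℝ) + 3) := by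
    have : ((2 * (27 * Q / q + 3)).toNat : ℤ) = 2 * (27 * Q / q + 3) := by omega
    exact_mod_cast this
  have h4 : ((27 * Q / q : ℤ) : ℝ) ≤ 27 * (Q / q) := by
    have : ((q * (27 * Q / q) : ℤ) : ℝ) ≤ ((27 * Q : ℤ) : ℝ) := by
      exact_mod_cast (ediv_mul_bounds (27 * Q) (by omega : 0 < q)).1
    push_cast at this
    rw [← mul_div_assoc, le_div_iff₀ (by positivity), mul_comm]
    exact this
  have h5 : (1 : ℝ) ≤ Q / q := by rwa [one_le_div (by positivity)]
  rw [h3, ← div_pow]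
  nlinarith

theorem second_loop_spec (hM : 60 * (51 + 48 * c) ≤ M) (hw : 0 ≤ w)
    (hE : FilterSpec M X N N' S T E w)
    {s : State} (hs : Bounded M s) (h0 : s 0 = X) (hq : 1 ≤ s 3) (hqQ : s 3 ≤ s 1)
    (h9 : s 9 = 2 * (27 * s 1 / s 3 + 3)) :
    Spec M S (loop 9 (thirdProg c E)) s (secondWork c w * ((s 1 : ℝ) ^ 2 / (s 3 : ℝ) ^ 2))
      {v ∈ T | HitsSecond c N N' (s 1) (s 2) (s 3) (s 5) (s 7) (s 8) v}
      (fun s' => Bounded M s' ∧ ∀ i, i < 9 → s' i = s i) := by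
  have hM2 : 2 ≤ M := by omega
  have hw1 := candidateWork_nonneg hw
  have hw2 := thirdOverhead_nonneg (c := c) hw
  have hdiv : 0 ≤ 27 * s 1 / s 3 := Int.ediv_nonneg (by omega) (by omega)
  set g := (2 * s 3 * s 5 * s 7 - 3 * s 2 * s 2) / (s 3 * s 3) - (27 * s 1 / s 3 + 3) with hg
  set h := 3 * s 2 * s 2 + s 3 * (s 3 * g - 2 * s 5 * s 7) with hh
  obtain ⟨n, hn⟩ : ∃ n : ℕ, n = (2 * (27 * s 1 / s 3 + 3)).toNat := ⟨_, rfl⟩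
  have hn' : (n : ℤ) = 2 * (27 * s 1 / s 3 + 3) := by omega
  refine (Spec.forLoop hM2 (i := 9) (P := thirdProg c E)
    (I := fun s' => Bounded M s' ∧ ∀ i, i < 9 → s' i = s i)
    (W := fun j => 2 * (candidateWork w + 44) *
      (halfWidth (51 + 48 * c) (s 1) (s 3) (h + s 3 ^ 2 * (j : ℤ)) : ℝ) + thirdOverhead c w)
    (D := fun j => {v ∈ T | HitsThird c N N' (s 1) (s 2) (s 3) (s 5) (s 7) (s 8) (g + j) v})
    (fun _ h => h.1) ?_ ?_ n s (by rw [h9, hn']) ⟨hs, fun _ _ => rfl⟩).mono ?_ ?_ ?_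
  · rintro j t - h9 ⟨hb, hf⟩
    refine (third_spec hM hE hb (by rw [hf 0 (by norm_num), h0])).mono (le_of_eq ?_) ?_ ?_
    · simp only [hf 1 (by norm_num), hf 2 (by norm_num), hf 3 (by norm_num), hf 5 (by norm_num),
        hf 7 (by norm_num), h9, ← hg]
      rw [hh]
      ring_nf
    · simp only [hf 1 (by norm_num), hf 2 (by norm_num), hf 3 (by norm_num), hf 5 (by norm_num),
        hf 7 (by norm_num), hf 8 (by norm_num), h9, ← hg]
      exact le_rfl
    · rintro s' ⟨b', f'⟩
      exact ⟨⟨b', fun i hi => by rw [f' i (by omega), hf i hi]⟩, by rw [f' 9 (by norm_num), h9]⟩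
  · rintro t ⟨hb, hf⟩ h
    refine ⟨hb.dec h, fun i hi => ?_⟩
    rw [Function.update_of_ne (by omega), hf i hi]
  · have hu := one_le_ratio hq hqQ
    have hnu := second_count_le hq hqQ
    rw [← hn] at hnu
    have hsum := sum_halfWidth_le (K := 51 + 48 * c) (Q := s 1) (q := s 3) (h := h)
      (by positivity) hq n
    rw [Finset.sum_add_distrib, Finset.sum_add_distrib, ← Finset.mul_sum]
    simp only [Finset.sum_const, Nat.card_Icc, add_tsub_cancel_right, nsmul_eq_mul, regDeg,
      secondWork]
    push_cast at hsum ⊢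
    generalize (s 1 : ℝ) ^ 2 / (s 3 : ℝ) ^ 2 = u at hu hnu hsum ⊢
    generalize (∑ j ∈ Finset.Icc 1 n,
      (halfWidth (51 + 48 * c) (s 1) (s 3) (h + s 3 ^ 2 * (j : ℤ)) : ℝ)) = σ at hsum ⊢
    have h1 : σ ≤ (480 * (51 + 48 * c) + 180) * u := by linarith
    have h2 := mul_le_mul_of_nonneg_left h1 (by positivity : 0 ≤ 2 * (candidateWork w + 44))
    have h3 := mul_le_mul_of_nonneg_right hnu (by positivity : 0 ≤ thirdOverhead c w + 32)
    linarith
  · rintro v ⟨hv, B, h1, h2, h3⟩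
    simp only [Set.mem_iUnion, Finset.mem_Icc]
    rw [← hg] at h1 h2
    refine ⟨(B - g).toNat, ⟨by omega, by omega⟩, hv, ?_⟩
    have : g + ((B - g).toNat : ℤ) = B := by omega
    rwa [this]
  · exact fun _ h => h

noncomputable def firstWork (c : ℕ) (w : ℝ) : ℝ :=
  (29 + 4 * c) * ((firstCoordExpr c).coef + discExpr.coef + secondCountExpr.coef + 29 +
    secondWork c w) + 4

/-- The pair `v` is found from the first coordinate in its window. -/
def HitsFirst (c N N' : ℕ) (Q p q s : ℤ) (v : ℤ × ℤ) : Prop :=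
  ∃ C : ℤ, 1 ≤ C + p * p * p / q + (15 + 2 * c) ∧ C + p * p * p / q + (15 + 2 * c) ≤ 29 + 4 * c ∧
    HitsSecond c N N' Q p q s C (p * p * p + q * C) v

theorem first_loop_spec (hM : 60 * (51 + 48 * c) ≤ M) (hw : 0 ≤ w)
    (hE : FilterSpec M X N N' S T E w)
    {s : State} (hs : Bounded M s) (h0 : s 0 = X) (hq : 1 ≤ s 3) (hqQ : s 3 ≤ s 1)
    (h6 : s 6 = 29 + 4 * c) :
    Spec M S (loop 6 (secondProg c E)) s (firstWork c w * ((s 1 : ℝ) ^ 2 / (s 3 : ℝ) ^ 2))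
      {v ∈ T | HitsFirst c N N' (s 1) (s 2) (s 3) (s 5) v}
      (fun s' => Bounded M s' ∧ ∀ i, i < 6 → s' i = s i) := by
  have hM2 : 2 ≤ M := by omega
  have hw2 := secondWork_nonneg (c := c) hw
  have hu := one_le_ratio hq hqQ
  set u := (s 1 : ℝ) ^ 2 / (s 3 : ℝ) ^ 2 with hudef
  refine (Spec.forLoop hM2 (i := 6) (P := secondProg c E)
    (I := fun s' => Bounded M s' ∧ ∀ i, i < 6 → s' i = s i)
    (W := fun j => (firstCoordExpr c).coef + 2 + (discExpr.coef + 2 + (secondCountExpr.coef + 2 +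
      secondWork c w * u)))
    (D := fun j => {v ∈ T | HitsSecond c N N' (s 1) (s 2) (s 3) (s 5)
      (j - s 2 * s 2 * s 2 / s 3 - (15 + 2 * c))
      (s 2 * s 2 * s 2 + s 3 * (j - s 2 * s 2 * s 2 / s 3 - (15 + 2 * c))) v})
    (fun _ h => h.1) ?_ ?_ (29 + 4 * c) s (by rw [h6]; push_cast; rfl)
    ⟨hs, fun _ _ => rfl⟩).mono ?_ ?_ ?_
  · rintro j t - h6 ⟨hb, hf⟩
    refine Spec.assign_seq hM2 hb ?_ (natAbs_eval_le_regDeg hM2 hb ?_ (Nat.le_of_ble_eq_true rfl))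
      fun t1 b1 e1 f1 => ?_
    iterate 2 simp [firstCoordExpr]; omega
    refine Spec.assign_seq hM2 b1 ?_ (natAbs_eval_le_regDeg hM2 b1 ?_ (by decide))
      fun t2 b2 e2 f2 => ?_
    iterate 2 simp [discExpr]
    refine Spec.assign_seq hM2 b2 ?_ (natAbs_eval_le_regDeg hM2 b2 ?_ (by decide))
      fun t3 b3 e3 f3 => ?_
    iterate 2 simp [secondCountExpr]; omega
    have g : ∀ i, i < 7 → t3 i = t i := fun i hi => by
      rw [f3 i (by omega), f2 i (by omega), f1 i (by omega)]
    have g' : ∀ i, i < 6 → t3 i = s i := fun i hi => by rw [g i (by omega), hf i hi]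
    have r7 : t3 7 = j - s 2 * s 2 * s 2 / s 3 - (15 + 2 * c) := by
      rw [f3 7 (by norm_num), f2 7 (by norm_num), e1]
      simp [firstCoordExpr, h6, hf]
    have r8 : t3 8 = s 2 * s 2 * s 2 + s 3 * (j - s 2 * s 2 * s 2 / s 3 - (15 + 2 * c)) := by
      rw [f3 8 (by norm_num), e2, ← r7, f3 7 (by norm_num), f2 7 (by norm_num)]
      simp [discExpr, f1, hf]
    refine (second_loop_spec hM hw hE b3 (by rw [g' 0 (by norm_num), h0])
      (by rwa [g' 3 (by norm_num)]) (by rwa [g' 3 (by norm_num), g' 1 (by norm_num)])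
      (by rw [e3]; simp [secondCountExpr, f3])).mono ?_ ?_ ?_
    · rw [g' 3 (by norm_num), g' 1 (by norm_num)]
    · rw [r7, r8, g' 1 (by norm_num), g' 2 (by norm_num), g' 3 (by norm_num), g' 5 (by norm_num)]
    · rintro s' ⟨b', f'⟩
      exact ⟨⟨b', fun i hi => by rw [f' i (by omega), g' i hi]⟩,
        by rw [f' 6 (by norm_num), g 6 (by norm_num), h6]⟩
  · rintro t ⟨hb, hf⟩ h
    refine ⟨hb.dec h, fun i hi => ?_⟩
    rw [Function.update_of_ne (by omega), hf i hi]
  · simp only [Finset.sum_const, Nat.card_Icc, add_tsub_cancel_right, nsmul_eq_mul, firstWork,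
      regDeg]
    push_cast
    have h1 : (0 : ℝ) ≤ ((firstCoordExpr c).coef + discExpr.coef + secondCountExpr.coef + 29) *
      (u - 1) := mul_nonneg (by positivity) (by linarith)
    have h2 : (0 : ℝ) ≤ 29 + 4 * (c : ℝ) := by positivity
    nlinarith [mul_nonneg h2 h1]
  · rintro v ⟨hv, C, h1, h2, h3⟩
    simp only [Set.mem_iUnion, Finset.mem_Icc]
    -- The shift `15 + 2c` makes the window of `first_window`, with `D = 13 + 2c`, start at counter
    -- `1`.
    refine ⟨(C + s 2 * s 2 * s 2 / s 3 + (15 + 2 * c)).toNat, ⟨by omega, by omega⟩, hv, ?_⟩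
    have : ((C + s 2 * s 2 * s 2 / s 3 + (15 + 2 * c)).toNat : ℤ) - s 2 * s 2 * s 2 / s 3 -
      (15 + 2 * c) = C := by omega
    rwa [this]
  · exact fun _ h => h

/-! ### One fraction, and the passage through all fractions of a level -/

/-- The pairs of `T` at scale `Q` whose root is close to a fraction congruent to `b.1 / b.2`. -/
def nearSet (N : ℕ) (T : Set (ℤ × ℤ)) (Q : ℤ) (b : ℤ × ℤ) : Set (ℤ × ℤ) :=
  {v ∈ T | Q ^ 4 ≤ N * v.1 ∧ N * v.1 < 16 * Q ^ 4 ∧ ∃ P : ℤ, P % b.2 = b.1 ∧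
    |(P : ℝ) - b.2 * Real.sqrt ((N * v.1 : ℤ) : ℝ)| ≤ 1 / (Q + 1)}

/-- What is required of the pairs to be found. -/
def Target (X N N' c : ℕ) (T : Set (ℤ × ℤ)) : Prop :=
  ∀ v ∈ T, 1 ≤ N * v.1 ∧ N * v.1 ≤ N * X ∧
    |((N : ℤ) * v.1) ^ 3 - (N' * v.2) ^ 2| ≤ c * (N * v.1)

/-- Completeness of the search at one fraction: the coordinates supplied by `exists_coords` lie in
the three windows through which the loops run, and the exact divisions there return the pair. -/
theorem hitsFirst_of_mem_nearSet (hT : Target X N N' c T) (hc : 1 ≤ c) {Q p q r s : ℤ}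
    (h : FareyPair Q p q r s) {v : ℤ × ℤ} (hv : v ∈ nearSet N T Q (p, q)) :
    HitsFirst c N N' Q p q s v := by
  obtain ⟨hvT, h1, h2, P, hP, hd⟩ := hv
  have hxy := (hT v hvT).2.2
  -- `exists_coords` needs a nonnegative second component. The sign is restored when the filter
  -- writes both signs.
  rw [← sq_abs (N' * v.2)] at hxy
  have hq := h.one_le_q
  obtain ⟨C, B, A, d, H, Z, ed, eH, eZ, ex, ey, bd, bH, Z0, bZ, bW⟩ :=
    exists_coords (c := c) (by exact_mod_cast hc) (hq.trans h.q_le) hq h.q_le h.det h1 h2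
      (abs_nonneg _) hxy hP (by exact_mod_cast hd)
  have hC := first_window hq ed bd
  have hB := second_window (Q := Q) (q := q) (u := 2 * q * s * C - 3 * p * p) (B := B) hq
    (by rw [eH]; ring) bH
  have hA := third_window (K := 3 * (17 + 16 * c)) (z := 3 * p + q * s * (C * s - B * q)) (A := A)
    (by omega) hq eZ Z0 bZ bW
  have e2 : q ^ 2 = q * q := by ring
  have e3 : p ^ 3 = p * p * p := by ring
  have e4 : q ^ 3 = q * q * q := by ring
  have e5 : (3 * (17 + 16 * c) : ℤ) = 51 + 48 * c := by ring
  rw [e3] at hC ed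
  rw [e2] at hB
  rw [e4] at hA eZ
  rw [e5] at hA
  refine ⟨C, by omega, by omega, B, by omega, by omega, A, H, Z, by rw [eH]; ring, eZ, ?_, ?_, ?_⟩
  · rw [← ed]; exact hA
  · symm
    apply Int.ediv_eq_of_eq_mul_right (by positivity)
    linarith
  · symm
    apply Int.ediv_eq_of_eq_mul_right (by positivity)
    rw [← ed]
    linarith

/-- The work for going to the next fraction. -/
def nextWork : ℕ :=
  ((reg 1 + reg 3) / reg 5).coef + (reg 13 * reg 4 - reg 2).coef +
    (reg 13 * reg 5 - reg 3).coef + (reg 4).coef + (reg 5).coef + (reg 16).coef + (reg 17).coef + 15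

/-- Counting degrees would let the registers `2` to `5` grow from one fraction to the next. Their
bound by `M` comes from the Farey property instead: denominators are at most `Q`, and the new
numerators at most `Q + 1`. -/
theorem next_spec (hM : 2 ≤ M) {s : State} (hs : Bounded M s)
    (hQ : s 1 + 1 ≤ M) (hF : FareyPair (s 1) (s 2) (s 3) (s 4) (s 5)) (hpq : s 2 < s 3) :
    Spec M S nextProg s nextWork ∅ (fun s' => Bounded M s' ∧ s' 0 = s 0 ∧ s' 1 = s 1 ∧
      s' 2 = s 4 ∧ s' 3 = s 5 ∧ s' 4 = (s 1 + s 3) / s 5 * s 4 - s 2 ∧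
      s' 5 = (s 1 + s 3) / s 5 * s 5 - s 3) := by
  have hr := hF.r_le hpq
  have hF' := hF.next
  have hr' := hF'.r_le' hr
  have := hF'.r_nonneg
  have := hF'.s_le
  have := hF'.one_le_s
  have := hF.r_nonneg
  have := hF.s_le
  have := hF.one_le_s
  generalize h4 : (s 1 + s 3) / s 5 * s 4 - s 2 = r' at *
  generalize h5 : (s 1 + s 3) / s 5 * s 5 - s 3 = s5 at *
  refine Spec.mono (W := ((reg 1 + reg 3) / reg 5).coef + 2 + ((reg 13 * reg 4 - reg 2).coef + 2 +
    ((reg 13 * reg 5 - reg 3).coef + 2 + ((reg 4).coef + 2 + ((reg 5).coef + 2 +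
    ((reg 16).coef + 2 + ((reg 17).coef + 2 + 1))))))) (D := ∅) (R := fun s' => Bounded M s' ∧
      s' 0 = s 0 ∧ s' 1 = s 1 ∧ s' 2 = s 4 ∧ s' 3 = s 5 ∧ s' 4 = r' ∧ s' 5 = s5)
    ?_ ?_ le_rfl (fun _ h => h)
  · refine Spec.assign_seq hM hs ?_ (natAbs_eval_le_regDeg hM hs ?_ (by decide))
      fun s1 b1 e1 f1 => ?_
    iterate 2 simp
    refine Spec.assign_seq hM b1 ?_ (natAbs_eval_le_regDeg hM b1 ?_ (by decide))
      fun s2 b2 e2 f2 => ?_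
    iterate 2 simp
    refine Spec.assign_seq hM b2 ?_ (natAbs_eval_le_regDeg hM b2 ?_ (by decide))
      fun s3 b3 e3 f3 => ?_
    iterate 2 simp
    have g3 : ∀ i, i < 13 → s3 i = s i := fun i hi => by
      rw [f3 i (by omega), f2 i (by omega), f1 i (by omega)]
    have r16 : s3 16 = r' := by
      rw [f3 16 (by norm_num), e2, ← h4]
      simp [e1, f1]
    have r17 : s3 17 = s5 := by
      rw [e3, ← h5]
      simp [f2, e1, f1]
    refine Spec.assign_seq hM b3 (by simp) ?_ fun s4 b4 e4 f4 => ?_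
    · simp [regDeg, g3]; omega
    refine Spec.assign_seq hM b4 (by simp) ?_ fun s5 b5 e5 f5 => ?_
    · simp [regDeg, f4, g3]; omega
    refine Spec.assign_seq hM b5 (by simp) ?_ fun s6 b6 e6 f6 => ?_
    · simp [regDeg, f5, f4, r16]; omega
    refine Spec.assign_seq hM b6 (by simp) ?_ fun s7 b7 e7 f7 => ?_
    · simp [regDeg, f6, f5, f4, r17]; omega
    refine (Spec.skip hM s7).mono le_rfl le_rfl ?_
    rintro _ rfl
    refine ⟨b7, ?_, ?_, ?_, ?_, ?_, ?_⟩
    · simp [f7, f6, f5, f4, g3]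
    · simp [f7, f6, f5, f4, g3]
    · simp [f7, f6, f5, e4, g3]
    · simp [f7, f6, e5, f4, g3]
    · simp [f7, e6, f5, f4, r16]
    · simp [e7, f6, f5, f4, r17]
  · unfold nextWork
    push_cast
    linarith

noncomputable def fractionWork (c : ℕ) (w : ℝ) : ℝ := firstWork c w + nextWork + 6

theorem firstWork_nonneg (hw : 0 ≤ w) : 0 ≤ firstWork c w := by
  have := secondWork_nonneg (c := c) hw
  unfold firstWork; positivity

theorem fraction_spec (hM : 60 * (51 + 48 * c) ≤ M) (hw : 0 ≤ w) (hc : 1 ≤ c)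
    (hE : FilterSpec M X N N' S T E w) (hT : Target X N N' c T)
    {s : State} (hs : Bounded M s) (h0 : s 0 = X)
    (hQ : s 1 + 1 ≤ M) (hF : FareyPair (s 1) (s 2) (s 3) (s 4) (s 5)) (hpq : s 2 < s 3) :
    Spec M S (fractionProg c E) s (fractionWork c w * ((s 1 : ℝ) ^ 2 / (s 3 : ℝ) ^ 2))
      (nearSet N T (s 1) (s 2, s 3)) (fun s' => Bounded M s' ∧ s' 0 = s 0 ∧ s' 1 = s 1 ∧
      s' 2 = s 4 ∧ s' 3 = s 5 ∧ s' 4 = (s 1 + s 3) / s 5 * s 4 - s 2 ∧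
      s' 5 = (s 1 + s 3) / s 5 * s 5 - s 3) := by
  have hM2 : 2 ≤ M := by omega
  have hu := one_le_ratio hF.one_le_q hF.q_le
  set u := (s 1 : ℝ) ^ 2 / (s 3 : ℝ) ^ 2 with hudef
  have hc6 : (const (29 + 4 * (c : ℤ))).ConstLE M := by simp; omega
  refine (Spec.assign_seq hM2 hs hc6 (natAbs_eval_le_regDeg hM2 hs hc6
    (Nat.le_of_ble_eq_true rfl)) (W := firstWork c w * u + nextWork + 1)
    (D := nearSet N T (s 1) (s 2, s 3)) fun s1 b1 e1 f1 => ?_).mono ?_ le_rfl (fun _ h => h)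
  · have h1 := first_loop_spec hM hw hE b1 (by rw [f1 0 (by norm_num), h0])
      (by rw [f1 3 (by norm_num)]; exact hF.one_le_q)
      (by rw [f1 3 (by norm_num), f1 1 (by norm_num)]; exact hF.q_le) e1
    have g1 : ∀ i, i < 6 → s1 i = s i := fun i hi => f1 i (by omega)
    refine (Spec.seq hM2 (W' := nextWork) (D' := ∅) (R' := fun s' => Bounded M s' ∧ s' 0 = s 0 ∧
      s' 1 = s 1 ∧ s' 2 = s 4 ∧ s' 3 = s 5 ∧ s' 4 = (s 1 + s 3) / s 5 * s 4 - s 2 ∧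
      s' 5 = (s 1 + s 3) / s 5 * s 5 - s 3) h1 (fun s2 hs2 => ?_)).mono ?_ ?_ (fun _ h => h)
    · have g2 : ∀ i, i < 6 → s2 i = s i := fun i hi => by rw [hs2.2 i hi, g1 i hi]
      have h2 := next_spec hM2 (S := S) hs2.1
      simp only [g2 0 (by norm_num), g2 1 (by norm_num), g2 2 (by norm_num), g2 3 (by norm_num),
        g2 4 (by norm_num), g2 5 (by norm_num)] at h2
      exact h2 hQ hF hpq
    · rw [g1 1 (by norm_num), g1 3 (by norm_num)]
    · rw [g1 1 (by norm_num), g1 2 (by norm_num), g1 3 (by norm_num), g1 5 (by norm_num)]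
      exact fun v hv => Or.inl ⟨hv.1, hitsFirst_of_mem_nearSet hT hc hF hv⟩
  · have := firstWork_nonneg (c := c) hw
    have h4 : ((const (29 + 4 * (c : ℤ))).coef : ℝ) = 3 := by simp [Expr.coef]
    rw [h4, fractionWork]
    have : (0 : ℝ) ≤ (nextWork + 6) * (u - 1) := mul_nonneg (by positivity) (by linarith)
    linarith

/-- Induction on the number of fractions still ahead; by `FareyPair.fareyFrom_eq` each turn removes
exactly the current one. -/
theorem farey_loop_spec (hM : 60 * (51 + 48 * c) ≤ M) (hw : 0 ≤ w) (hc : 1 ≤ c)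
    (hE : FilterSpec M X N N' S T E w) (hT : Target X N N' c T) {Q : ℤ} (hQ : Q + 1 ≤ M) (n : ℕ) :
    ∀ s : State, Bounded M s → s 0 = X → s 1 = Q → FareyPair Q (s 2) (s 3) (s 4) (s 5) →
      s 2 ≤ s 3 → (fareyFrom Q (s 2) (s 3)).card = n →
      Spec M S (.whilePos (reg 3 - reg 2) (fractionProg c E)) s
        (∑ b ∈ fareyFrom Q (s 2) (s 3), (fractionWork c w + 20) * ((Q : ℝ) ^ 2 / (b.2 : ℝ) ^ 2) + 20)
        (⋃ b ∈ fareyFrom Q (s 2) (s 3), nearSet N T Q b)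
        (fun s' => Bounded M s' ∧ s' 0 = X ∧ s' 1 = Q) := by
  have hM2 : 2 ≤ M := by omega
  have hcoef : (((reg 3 - reg 2 : Expr).coef : ℕ) : ℝ) = 12 := by
    have : (reg 3 - reg 2 : Expr).coef = 12 := rfl
    rw [this]; norm_num
  induction n with
  | zero =>
    intro s hs h0 h1 hF hpq hcard
    have hle : s 3 ≤ s 2 := by
      by_contra hlt
      rw [hF.fareyFrom_eq (by omega), Finset.card_insert_of_notMem hF.notMem] at hcard
      omega
    rw [Finset.card_eq_zero.1 hcard]
    refine (Spec.while_stop hM2 hs (by simp) (by simp; omega)).mono ?_ ?_ ?_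
    · rw [hcoef]; norm_num
    · simp
    · rintro _ rfl; exact ⟨hs, h0, h1⟩
  | succ n ih =>
    intro s hs h0 h1 hF hpq hcard
    have hlt : s 2 < s 3 := by
      by_contra hle
      rw [fareyFrom_eq_empty hF.one_le_q (by omega)] at hcard
      simp at hcard
    have hfr := fraction_spec hM hw hc hE hT hs h0 (by rw [h1]; exact hQ) (by rw [h1]; exact hF) hlt
    rw [h1] at hfr
    rw [hF.fareyFrom_eq hlt, Finset.card_insert_of_notMem hF.notMem] at hcard
    rw [hF.fareyFrom_eq hlt, Finset.sum_insert hF.notMem]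
    refine (Spec.while_step hM2 hs (by simp) (by simp; omega) hfr
      (W' := ∑ b ∈ fareyFrom Q (s 4) (s 5),
        (fractionWork c w + 20) * ((Q : ℝ) ^ 2 / (b.2 : ℝ) ^ 2) + 20)
      (D' := ⋃ b ∈ fareyFrom Q (s 4) (s 5), nearSet N T Q b)
      (R' := fun s' => Bounded M s' ∧ s' 0 = X ∧ s' 1 = Q) fun s' ⟨hb, k0, k1, k2, k3, k4, k5⟩ => ?_).mono
      ?_ ?_ (fun _ h => h)
    · have := ih s' hb (by rw [k0, h0]) k1
        (by rw [k2, k3, k4, k5]; exact hF.next) (by rw [k2, k3]; exact hF.r_le hlt)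
        (by rw [k2, k3]; omega)
      rwa [k2, k3] at this
    · have hu := one_le_ratio hF.one_le_q hF.q_le
      rw [hcoef]
      linarith
    · simp

/-! ### Dirichlet approximation and one scale -/

/-- Dirichlet's theorem for the square root, in lowest terms. Reducing the numerator modulo the
denominator keeps the fraction reduced and moves it into `[0, 1)`. -/
theorem exists_mem_nearSet {Q : ℕ} (hQ : 1 ≤ Q) {v : ℤ × ℤ} (hv : v ∈ T)
    (h1 : (Q : ℤ) ^ 4 ≤ N * v.1) (h2 : N * v.1 < 16 * (Q : ℤ) ^ 4) :
    ∃ b ∈ fareyFrom Q 0 1, v ∈ nearSet N T Q b := by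
  obtain ⟨x, hx, hxQ⟩ := Real.exists_rat_abs_sub_le_and_den_le
    (Real.sqrt ((N * v.1 : ℤ) : ℝ)) (by omega : 0 < Q)
  have hd : (0 : ℤ) < x.den := by exact_mod_cast x.den_pos
  refine ⟨(x.num % x.den, x.den), mem_fareyFrom.2 ⟨Int.emod_nonneg _ hd.ne', Int.emod_lt_of_pos _ hd,
    Int.ofNat_le.2 hxQ, ?_, ?_⟩, hv, h1, h2, x.num, rfl, ?_⟩
  · have : IsCoprime x.num x.den := Rat.isCoprime_num_den x
    rw [Int.emod_def]
    simpa [sub_eq_add_neg, ← mul_neg] using this.add_mul_left_left (-(x.num / x.den))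
  · simpa using Int.emod_nonneg _ hd.ne'
  · have hdr : (0 : ℝ) < x.den := by exact_mod_cast x.den_pos
    have e : (x.num : ℝ) = x.den * x := by
      have := Rat.den_mul_eq_num x
      exact_mod_cast this.symm
    have : |(x.num : ℝ) - x.den * Real.sqrt ((N * v.1 : ℤ) : ℝ)| =
        x.den * |Real.sqrt ((N * v.1 : ℤ) : ℝ) - x| := by
      rw [e, ← mul_sub, abs_mul, abs_of_pos hdr, abs_sub_comm]
    simp only [Int.cast_natCast]
    rw [this]
    calc (x.den : ℝ) * |Real.sqrt ((N * v.1 : ℤ) : ℝ) - x|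
        ≤ x.den * (1 / ((Q + 1) * x.den)) := by gcongr
      _ = 1 / (Q + 1) := by field_simp

noncomputable def scaleWork (c : ℕ) (w : ℝ) : ℝ := fractionWork c w + 100

theorem fractionWork_nonneg (hw : 0 ≤ w) : 0 ≤ fractionWork c w := by
  have := firstWork_nonneg (c := c) hw
  unfold fractionWork; positivity

theorem scale_spec (hM : 60 * (51 + 48 * c) ≤ M) (hw : 0 ≤ w) (hc : 1 ≤ c)
    (hE : FilterSpec M X N N' S T E w) (hT : Target X N N' c T) {Q : ℕ} (hQ1 : 1 ≤ Q)
    (hQ : 2 * Q ≤ M) {s : State} (hs : Bounded M s) (h0 : s 0 = X) (h1 : s 1 = Q) :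
    Spec M S (scaleProg c E) s (scaleWork c w * ((Q : ℝ) ^ 2 * (1 + Real.log Q)))
      {v ∈ T | (Q : ℤ) ^ 4 ≤ N * v.1 ∧ N * v.1 < 16 * (Q : ℤ) ^ 4}
      (fun s' => Bounded M s' ∧ s' 0 = X ∧ s' 1 = (2 * Q : ℕ)) := by
  have hM2 : 2 ≤ M := by omega
  have hf := fractionWork_nonneg (c := c) hw
  refine Spec.mono (W := 3 + 2 + (3 + 2 + (3 + 2 + (3 + 2 +
    (((fractionWork c w + 20) * ((Q : ℝ) ^ 2 * (1 + Real.log Q)) + 20) + (12 + 2 + 1) + 1)))))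
    (D := {v ∈ T | (Q : ℤ) ^ 4 ≤ N * v.1 ∧ N * v.1 < 16 * (Q : ℤ) ^ 4})
    (R := fun s' => Bounded M s' ∧ s' 0 = X ∧ s' 1 = (2 * Q : ℕ)) ?_ ?_ le_rfl (fun _ h => h)
  · have c0 : (((const 0).coef : ℕ) : ℝ) = 3 := by simp [Expr.coef]
    have c1 : (((const 1).coef : ℕ) : ℝ) = 3 := by simp [Expr.coef]
    have c2 : (((reg 1).coef : ℕ) : ℝ) = 3 := by simp [Expr.coef, regDeg]
    have c3 : (((reg 1 + reg 1 : Expr).coef : ℕ) : ℝ) = 12 := by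
      have : (reg 1 + reg 1 : Expr).coef = 12 := rfl
      rw [this]; norm_num
    rw [← c3]
    refine Spec.mono (W := (const 0).coef + 2 + ((const 1).coef + 2 + ((const 1).coef + 2 +
      ((reg 1).coef + 2 + (((fractionWork c w + 20) * ((Q : ℝ) ^ 2 * (1 + Real.log Q)) + 20) +
      ((reg 1 + reg 1 : Expr).coef + 2 + 1) + 1)))))
      (D := {v ∈ T | (Q : ℤ) ^ 4 ≤ N * v.1 ∧ N * v.1 < 16 * (Q : ℤ) ^ 4})
      (R := fun s' => Bounded M s' ∧ s' 0 = X ∧ s' 1 = (2 * Q : ℕ)) ?_ (by rw [c0, c1, c2]) le_rfl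
      (fun _ h => h)
    refine Spec.assign_seq hM2 hs (by simp) (by simp) fun s1 b1 e1 f1 => ?_
    refine Spec.assign_seq hM2 b1 (by simp; omega) (by simp [regDeg]; omega) fun s2 b2 e2 f2 => ?_
    refine Spec.assign_seq hM2 b2 (by simp; omega) (by simp [regDeg]; omega) fun s3 b3 e3 f3 => ?_
    refine Spec.assign_seq hM2 b3 (by simp) (natAbs_eval_le_regDeg hM2 b3 (by simp) (by decide))
      fun s4 b4 e4 f4 => ?_
    have r1 : s4 1 = Q := by simp [f4, f3, f2, f1, h1]
    have r2 : s4 2 = 0 := by simp [f4, f3, f2, e1]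
    have r3 : s4 3 = 1 := by simp [f4, f3, e2]
    have r4 : s4 4 = 1 := by simp [f4, e3]
    have r5 : s4 5 = Q := by simp [e4, f3, f2, f1, h1]
    -- The first two fractions of level `Q` are `0 / 1` and `1 / Q`.
    have hF : FareyPair (Q : ℤ) 0 1 1 Q :=
      ⟨by norm_num, le_rfl, by norm_num, le_rfl, by omega, by omega, le_rfl, by omega⟩
    have hloop := farey_loop_spec hM hw hc hE hT (Q := Q) (by omega) _ s4 b4
      (by simp [f4, f3, f2, f1, h0]) r1 (by rw [r2, r3, r4, r5]; exact hF) (by rw [r2, r3]; omega) rfl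
    rw [r2, r3] at hloop
    refine (Spec.seq hM2 hloop (W' := (reg 1 + reg 1 : Expr).coef + 2 + 1) (D' := ∅)
      (R' := fun s' => Bounded M s' ∧ s' 0 = X ∧ s' 1 = (2 * Q : ℕ)) fun s5 ⟨b5, k0, k1⟩ => ?_).mono
      ?_ ?_ (fun _ h => h)
    · refine Spec.assign_seq hM2 b5 (by simp) (by simp [regDeg, k1]; omega) fun s6 b6 e6 f6 => ?_
      refine (Spec.skip hM2 s6).mono le_rfl le_rfl ?_
      rintro _ rfl
      exact ⟨b6, by simp [f6, k0], by simp [e6, k1]; ring⟩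
    · rw [← Finset.mul_sum]
      have := mul_le_mul_of_nonneg_left (sum_fareyFrom_le Q)
        (by positivity : 0 ≤ fractionWork c w + 20)
      simp only [Int.cast_natCast]
      linarith
    · rintro v ⟨hv, k1, k2⟩
      obtain ⟨b, hb, hvb⟩ := exists_mem_nearSet hQ1 hv k1 k2
      exact Or.inl (Set.mem_biUnion hb hvb)
  · have hQr : (1 : ℝ) ≤ Q := by exact_mod_cast hQ1
    have h5 := Real.log_nonneg hQr
    have h6 : (1 : ℝ) ≤ (Q : ℝ) ^ 2 * (1 + Real.log Q) := by nlinarith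
    unfold scaleWork
    linarith

/-! ### All dyadic scales -/

/-- Positive as long as the scale is not too large. -/
def guardExpr (N : ℕ) : Expr := const N * reg 0 - reg 1 * reg 1 * reg 1 * reg 1 + const 1

noncomputable def searchWork (c N : ℕ) (w : ℝ) : ℝ := scaleWork c w + (guardExpr N).coef + 10

/-- The quantity `4 √(NX) - Q^2` serves as a potential: doubling `Q` lowers it by `3 Q^2`, which
pays for the scale `Q`. It stays nonnegative because a scale is treated only if `Q^4 ≤ NX`. -/
theorem scale_loop_spec (hM : 60 * (51 + 48 * c) ≤ M) (hw : 0 ≤ w) (hc : 1 ≤ c)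
    (hNX : 2 * (N * X) ≤ M) (hN : N ≤ M) (hNX1 : 1 ≤ N * X)
    (hE : FilterSpec M X N N' S T E w) (hT : Target X N N' c T) (n : ℕ) :
    ∀ (Q : ℕ) (s : State), 1 ≤ Q → Bounded M s → s 0 = X → s 1 = Q → N * X + 1 - Q ≤ n →
      (Q : ℝ) ^ 2 ≤ 4 * Real.sqrt (N * X : ℕ) →
      Spec M S (.whilePos (guardExpr N) (scaleProg c E)) s
        (searchWork c N w * (1 + Real.log (N * X : ℕ)) * (4 * Real.sqrt (N * X : ℕ) - (Q : ℝ) ^ 2) +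
          ((guardExpr N).coef + 1))
        {v ∈ T | (Q : ℤ) ^ 4 ≤ N * v.1} (fun _ => True) := by
  have hM2 : 2 ≤ M := by omega
  have hcl : (guardExpr N).ConstLE M := by simp [guardExpr]; omega
  have hf := fractionWork_nonneg (c := c) hw
  have hNXr : (1 : ℝ) ≤ (N * X : ℕ) := by exact_mod_cast hNX1
  have hlog := Real.log_nonneg hNXr
  have hsw : 0 ≤ scaleWork c w := by unfold scaleWork; linarith
  have hsW : 0 ≤ searchWork c N w := by unfold searchWork; positivity
  have hev : ∀ (Q : ℕ) (s : State), s 0 = X → s 1 = Q →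
      (guardExpr N).eval s = ((N * X : ℕ) : ℤ) - ((Q ^ 4 : ℕ) : ℤ) + 1 := by
    intro Q s h0 h1
    simp only [guardExpr, eval_add, eval_sub, eval_mul, eval_const, eval_reg, h0, h1]
    push_cast; ring
  have hlast : ∀ (Q : ℕ) (s : State), Bounded M s → s 0 = X → s 1 = Q → N * X < Q ^ 4 →
      (Q : ℝ) ^ 2 ≤ 4 * Real.sqrt (N * X : ℕ) →
      Spec M S (.whilePos (guardExpr N) (scaleProg c E)) s
        (searchWork c N w * (1 + Real.log (N * X : ℕ)) * (4 * Real.sqrt (N * X : ℕ) - (Q : ℝ) ^ 2) +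
          ((guardExpr N).coef + 1))
        {v ∈ T | (Q : ℤ) ^ 4 ≤ N * v.1} (fun _ => True) := by
    intro Q s hs h0 h1 hlt hQ4
    refine (Spec.while_stop hM2 hs hcl (by rw [hev Q s h0 h1]; omega)).mono ?_ ?_ (fun _ _ => trivial)
    · have : 0 ≤ searchWork c N w * (1 + Real.log (N * X : ℕ)) *
        (4 * Real.sqrt (N * X : ℕ) - (Q : ℝ) ^ 2) :=
        mul_nonneg (by positivity) (by linarith)
      linarith
    · rintro v ⟨hv, hle⟩
      have h2 := (hT v hv).2.1
      have h3 : ((Q ^ 4 : ℕ) : ℤ) ≤ ((N * X : ℕ) : ℤ) := by push_cast; linarith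
      omega
  induction n with
  | zero =>
    intro Q s hQ1 hs h0 h1 hn hQ4
    refine hlast Q s hs h0 h1 ?_ hQ4
    have : Q ≤ Q ^ 4 := Nat.le_self_pow (by norm_num) Q
    omega
  | succ n ih =>
    intro Q s hQ1 hs h0 h1 hn hQ4
    rcases lt_or_ge (N * X) (Q ^ 4) with hlt | hge
    · exact hlast Q s hs h0 h1 hlt hQ4
    have hQle : Q ≤ Q ^ 4 := Nat.le_self_pow (by norm_num) Q
    have hQs : (Q : ℝ) ^ 2 ≤ Real.sqrt (N * X : ℕ) := by
      apply Real.le_sqrt_of_sq_le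
      rw [← pow_mul]
      exact_mod_cast hge
    refine (Spec.while_step hM2 hs hcl (by rw [hev Q s h0 h1]; omega)
      (scale_spec hM hw hc hE hT hQ1 (by omega) hs h0 h1) (fun s' ⟨b', k0, k1⟩ =>
        ih (2 * Q) s' (by omega) b' k0 k1 (by omega)
          (by rw [Nat.cast_mul 2 Q, mul_pow]; norm_num at hQs ⊢; linarith))).mono ?_ ?_
      (fun _ h => h)
    · have hQr : (1 : ℝ) ≤ Q := by exact_mod_cast hQ1
      have hlogQ : Real.log Q ≤ Real.log (N * X : ℕ) := by
        apply Real.log_le_log (by linarith)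
        exact_mod_cast hQle.trans hge
      have hlogQ0 := Real.log_nonneg hQr
      have hQQ : (1 : ℝ) ≤ (Q : ℝ) ^ 2 := one_le_pow₀ hQr
      have hL : (Q : ℝ) ^ 2 * (1 + Real.log Q) ≤ (Q : ℝ) ^ 2 * (1 + Real.log (N * X : ℕ)) := by
        gcongr
      have hL1 : 1 ≤ (Q : ℝ) ^ 2 * (1 + Real.log (N * X : ℕ)) := by nlinarith
      have h2 := mul_le_mul_of_nonneg_left hL hsw
      have h3 : (0 : ℝ) ≤ (guardExpr N).coef := by positivity
      have h4 := mul_le_mul_of_nonneg_left hL1 (by positivity : (0 : ℝ) ≤ (guardExpr N).coef + 1)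
      have h5 : searchWork c N w * (1 + Real.log (N * X : ℕ)) *
          (4 * Real.sqrt (N * X : ℕ) - (Q : ℝ) ^ 2) - searchWork c N w *
          (1 + Real.log (N * X : ℕ)) * (4 * Real.sqrt (N * X : ℕ) - ((2 * Q : ℕ) : ℝ) ^ 2) =
          3 * (searchWork c N w * ((Q : ℝ) ^ 2 * (1 + Real.log (N * X : ℕ)))) := by
        push_cast; ring
      have h6 : searchWork c N w * ((Q : ℝ) ^ 2 * (1 + Real.log (N * X : ℕ))) =
          scaleWork c w * ((Q : ℝ) ^ 2 * (1 + Real.log (N * X : ℕ))) +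
          ((guardExpr N).coef + 1) * ((Q : ℝ) ^ 2 * (1 + Real.log (N * X : ℕ))) +
          9 * ((Q : ℝ) ^ 2 * (1 + Real.log (N * X : ℕ))) := by
        unfold searchWork; ring
      have h7 : 0 ≤ searchWork c N w * ((Q : ℝ) ^ 2 * (1 + Real.log (N * X : ℕ))) := by positivity
      linarith
    · rintro v ⟨hv, hle⟩
      rcases lt_or_ge (N * v.1) (16 * (Q : ℤ) ^ 4) with h | h
      · exact Or.inl ⟨hv, hle, h⟩
      · refine Or.inr ⟨hv, ?_⟩
        push_cast
        linarith

theorem search_spec (hM : 60 * (51 + 48 * c) ≤ M) (hw : 0 ≤ w) (hc : 1 ≤ c)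
    (hNX : 2 * (N * X) ≤ M) (hN : N ≤ M) (hN1 : 1 ≤ N) (hX : 1 ≤ X)
    (hE : FilterSpec M X N N' S T E w) (hT : Target X N N' c T) :
    Spec M S (searchProg c N E) (input X)
      (4 * searchWork c N w * (1 + Real.log (N * X : ℕ)) * Real.sqrt (N * X : ℕ)) T
      (fun _ => True) := by
  have hM2 : 2 ≤ M := by omega
  have hXN : X ≤ N * X := Nat.le_mul_of_pos_left X hN1
  have hNXr : (1 : ℝ) ≤ (N * X : ℕ) := by exact_mod_cast hX.trans hXN
  have hlog := Real.log_nonneg hNXr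
  have hb : Bounded M (input X) := by
    intro i
    unfold input
    split_ifs with h
    · subst h; simp [regDeg]; omega
    · simp
  have hsq : 1 ≤ Real.sqrt (N * X : ℕ) := Real.one_le_sqrt.2 hNXr
  refine (Spec.assign_seq hM2 hb (by simp; omega) (by simp [regDeg]; omega) (fun s1 b1 e1 f1 =>
    scale_loop_spec hM hw hc hNX hN (hX.trans hXN) hE hT (N * X) 1 s1 le_rfl b1
      (by simp [f1, input]) (by simp [e1]) (by omega) (by push_cast at hsq ⊢; linarith))).mono
      ?_ ?_ (fun _ h => h)
  · have h4 : ((const 1).coef : ℝ) = 3 := by simp [Expr.coef]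
    rw [h4]
    have h5 : searchWork c N w ≤ searchWork c N w * (1 + Real.log (N * X : ℕ)) := by
      have hf := fractionWork_nonneg (c := c) hw
      have : 0 ≤ searchWork c N w := by unfold searchWork scaleWork; positivity
      nlinarith
    have h6 : (guardExpr N).coef + 10 ≤ searchWork c N w := by
      have hf := fractionWork_nonneg (c := c) hw
      unfold searchWork scaleWork; linarith
    push_cast at *
    linarith
  · intro v hv
    exact ⟨hv, by simpa using (hT v hv).1⟩

/-! ### Bounds in terms of the input -/

theorem exists_one_add_log_le (m : ℕ) : ∃ A : ℝ, 0 ≤ A ∧ ∀ X : ℕ, 2 ≤ X →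
    1 + Real.log (m * X : ℕ) ≤ A * Real.log X := by
  have h2 : 0 < Real.log 2 := Real.log_pos (by norm_num)
  have h0 : 0 ≤ Real.log m := Real.log_natCast_nonneg m
  refine ⟨(1 + Real.log m) / Real.log 2 + 1, by positivity, fun X hX => ?_⟩
  have hX2 : Real.log 2 ≤ Real.log X := Real.log_le_log (by norm_num) (by exact_mod_cast hX)
  have h1 : 1 + Real.log m ≤ (1 + Real.log m) / Real.log 2 * Real.log X := by
    rw [div_mul_eq_mul_div, le_div_iff₀ h2]
    gcongr
  have h3 : Real.log (m * X : ℕ) ≤ Real.log m + Real.log X := by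
    rcases Nat.eq_zero_or_pos m with rfl | hm
    · simp; positivity
    · push_cast
      rw [Real.log_mul (by positivity) (by positivity)]
  linarith

theorem size_le_log {M : ℕ} (hM : 1 ≤ M) : (M.size : ℝ) ≤ 2 * (1 + Real.log M) := by
  have h1 : 1 ≤ M.size := Nat.lt_size.2 (by simpa using hM)
  have h2 : 2 ^ (M.size - 1) ≤ M := Nat.lt_size.1 (by omega)
  have h3 : ((M.size - 1 : ℕ) : ℝ) * Real.log 2 ≤ Real.log M := by
    rw [← Real.log_pow]
    exact Real.log_le_log (by positivity) (by exact_mod_cast h2)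
  rw [Nat.cast_sub h1] at h3
  have := Real.log_two_gt_d9
  have h4 : (1 : ℝ) ≤ M.size := by exact_mod_cast h1
  push_cast at h3
  nlinarith

/-- The search program finds `T` in time `O(X ^ (1 / 2) (log X) ^ 3)`, writing
`O(X ^ (1 / 2) log X)` pairs. -/
theorem exists_search {S T : ℕ → Set (ℤ × ℤ)} (hw : 0 ≤ w) (hc : 1 ≤ c) (hN : 1 ≤ N)
    (hT : ∀ X, 2 ≤ X → Target X N N' c (T X)) {M₀ : ℕ}
    (hE : ∀ M X, M₀ ≤ M → 2 ≤ M → 2 ≤ X → FilterSpec M X N N' (S X) (T X) E w) :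
    ∃ A : ℝ, 0 ≤ A ∧ ∀ X : ℕ, 2 ≤ X → ∃ (s' : State) (o : List (ℤ × ℤ)) (t : ℕ),
      Runs (searchProg c N E) (input X) s' o t ∧
      (t : ℝ) ≤ A * Real.sqrt X * Real.log X ^ 3 ∧ (o.length : ℝ) ≤ A * Real.sqrt X * Real.log X ∧
      (∀ v ∈ o, v ∈ S X) ∧ ∀ v ∈ T X, v ∈ o := by
  obtain ⟨A₁, hA₁, h₁⟩ := exists_one_add_log_le N
  -- `M = m * X` dominates the constants of the program as well as all scales, while its length is
  -- still `O(log X)`.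
  set m := 60 * (51 + 48 * c) + 2 * N + M₀ with hm
  obtain ⟨A₂, hA₂, h₂⟩ := exists_one_add_log_le m
  have hsW : 0 ≤ searchWork c N w := by
    have hf := fractionWork_nonneg (c := c) hw
    unfold searchWork scaleWork; positivity
  set A₀ := 4 * searchWork c N w * A₁ * Real.sqrt N with hA₀
  have hA₀0 : 0 ≤ A₀ := by positivity
  refine ⟨A₀ * (1 + (2 * A₂) ^ 2), by positivity, fun X hX => ?_⟩
  have hmX : m ≤ m * X := Nat.le_mul_of_pos_right m (by omega)
  have hNXM : 2 * (N * X) ≤ m * X := by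
    rw [← mul_assoc]; exact Nat.mul_le_mul_right X (by omega)
  obtain ⟨s', o, t, k1, k2, k3, k4, k5, -⟩ := search_spec (M := m * X) (X := X) (N := N) (N' := N')
    (by omega) hw hc hNXM (by omega) hN (by omega) (hE (m * X) X (by omega) (by omega) hX) (hT X hX)
  have hl : 0 ≤ Real.log X := Real.log_natCast_nonneg X
  have hW : 4 * searchWork c N w * (1 + Real.log (N * X : ℕ)) * Real.sqrt (N * X : ℕ) ≤
      A₀ * Real.sqrt X * Real.log X := by
    calc 4 * searchWork c N w * (1 + Real.log (N * X : ℕ)) * Real.sqrt (N * X : ℕ)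
        ≤ 4 * searchWork c N w * (A₁ * Real.log X) * Real.sqrt (N * X : ℕ) := by
          gcongr; exact h₁ X hX
      _ = A₀ * Real.sqrt X * Real.log X := by
          push_cast; rw [Real.sqrt_mul (by positivity), hA₀]; ring
  have hsz : ((m * X).size : ℝ) ≤ 2 * A₂ * Real.log X := by
    refine (size_le_log (by omega)).trans ?_
    have := h₂ X hX
    linarith
  refine ⟨s', o, t, k1, k2.trans ?_, (k3.trans hW).trans ?_, k4, k5⟩
  · calc _ ≤ A₀ * Real.sqrt X * Real.log X * (2 * A₂ * Real.log X) ^ 2 := by gcongr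
      _ = A₀ * (2 * A₂) ^ 2 * (Real.sqrt X * Real.log X ^ 3) := by ring
      _ ≤ A₀ * (1 + (2 * A₂) ^ 2) * (Real.sqrt X * Real.log X ^ 3) := by gcongr; linarith
      _ = _ := by ring
  · rw [mul_assoc, mul_assoc (A₀ * _)]
    gcongr
    nlinarith [sq_nonneg (2 * A₂)]

/-! ### Filters made of sign tests -/

/-- Run `P` if all expressions of the list are positive. -/
def Prog.guard (es : List Expr) (P : Prog) : Prog := es.foldr (fun e P => .ifPos e P .skip) P

theorem guard_spec (hM : 2 ≤ M) {s : State} (hs : Bounded M s) {P : Prog} {D : Set (ℤ × ℤ)}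
    (hw : 0 ≤ w) : ∀ {es : List Expr}, (∀ e ∈ es, e.ConstLE M) →
      ((∀ e ∈ es, 0 < e.eval s) → Spec M S P s w D (fun s' => s' = s)) →
      (D.Nonempty → ∀ e ∈ es, 0 < e.eval s) →
      Spec M S (guard es P) s ((es.map fun e => (e.coef + 1 : ℝ)).sum + (w + 1)) D
        (fun s' => s' = s)
  | [], _, hP, _ => (hP (by simp)).mono (by simp) le_rfl fun _ h => h
  | e :: es, hes, hP, hD => by
    rw [List.map_cons, List.sum_cons, add_assoc]
    have h0 : 0 ≤ (es.map fun e => (e.coef + 1 : ℝ)).sum :=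
      List.sum_nonneg (by simp only [List.mem_map]; rintro _ ⟨e, _, rfl⟩; positivity)
    refine Spec.ifPos hM hs (hes e (by simp)) (fun he => ?_) (fun he => ?_)
    · refine guard_spec hM hs hw (fun f hf => hes f (by simp [hf])) (fun h => hP ?_)
        (fun h f hf => hD h f (by simp [hf]))
      intro f hf
      rcases List.mem_cons.1 hf with rfl | hf
      exacts [he, h f hf]
    · refine (Spec.skip hM s).mono (by linarith) ?_ fun _ h => h
      intro v hv
      exact absurd (hD ⟨v, hv⟩ e (by simp)) (not_lt.2 he)

/-- The first component, scaled back. -/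
def candX (N : ℕ) : Expr := reg 16 / const N
/-- The second component, scaled back. -/
def candY (N' : ℕ) : Expr := reg 17 / const N'

/-- Write the candidate and its mirror image if all tests are positive. -/
def filterProg (N N' : ℕ) (es : List Expr) : Prog :=
  guard es (.seq (.emit (candX N) (candY N')) (.emit (candX N) (const 0 - candY N')))

noncomputable def filterWork (N N' : ℕ) (es : List Expr) : ℝ :=
  (es.map fun e => (e.coef + 1 : ℝ)).sum +
    (((candX N).coef + (candY N').coef + 1 + ((candX N).coef + (const 0 - candY N').coef + 1) + 1) + 1)

theorem filterWork_nonneg (N N' : ℕ) (es : List Expr) : 0 ≤ filterWork N N' es := by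
  have h0 : 0 ≤ (es.map fun e => (e.coef + 1 : ℝ)).sum :=
    List.sum_nonneg (by simp only [List.mem_map]; rintro _ ⟨e, _, rfl⟩; positivity)
  unfold filterWork; positivity

/-- No divisibility test is needed. The tests concern the quotients that are written, so a candidate
with inexact quotients writes nothing outside `S`; for a candidate coming from a pair of `T` the
quotients are exact. -/
theorem filterSpec_filterProg (hM : 2 ≤ M) (hN : 1 ≤ N) (hN' : 1 ≤ N') (hNM : N ≤ M) (hNM' : N' ≤ M)
    {es : List Expr} (hes : ∀ e ∈ es, e.ConstLE M)
    (h1 : ∀ s : State, s 0 = X → (∀ e ∈ es, 0 < e.eval s) →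
      (s 16 / N, s 17 / N') ∈ S ∧ (s 16 / N, -(s 17 / N')) ∈ S)
    (h2 : ∀ s : State, s 0 = X → ∀ v ∈ T, s 16 / N = v.1 → s 17 / N' = |v.2| →
      ∀ e ∈ es, 0 < e.eval s) :
    FilterSpec M X N N' S T (filterProg N N' es) (filterWork N N' es) := by
  intro s hs h0
  have hX : (candX N).ConstLE M := by simp [candX]; omega
  have hY : (candY N').ConstLE M := by simp [candY]; omega
  have hY' : (const 0 - candY N').ConstLE M := ⟨by simp, hY⟩
  have hcand : ∀ v : ℤ × ℤ, N * v.1 = s 16 → |N' * v.2| = s 17 →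
      s 16 / N = v.1 ∧ s 17 / N' = |v.2| := by
    intro v k1 k2
    rw [abs_mul, Nat.abs_cast] at k2
    rw [← k1, ← k2]
    exact ⟨Int.mul_ediv_cancel_left _ (by omega), Int.mul_ediv_cancel_left _ (by omega)⟩
  refine guard_spec hM hs (by positivity) hes (fun hpos => ?_) ?_
  · obtain ⟨m1, m2⟩ := h1 s h0 hpos
    refine (Spec.seq hM (Spec.emit hM hs hX hY (by simpa [candX, candY] using m1))
      (W' := (candX N).coef + (const 0 - candY N').coef + 1) (D' := {(s 16 / N, -(s 17 / N'))})
      (R' := fun s' => s' = s) ?_).mono le_rfl ?_ fun _ h => h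
    · rintro _ rfl
      refine (Spec.emit hM hs hX hY' (by simpa [candX, candY] using m2)).mono le_rfl ?_ fun _ h => h
      simp [candX, candY]
    · rintro v ⟨hv, k1, k2⟩
      obtain ⟨k3, k4⟩ := hcand v k1 k2
      rcases abs_choice v.2 with h | h
      · left; simp [candX, candY, k3, k4, h]
      · right; simp [k3, k4, h]
  · rintro ⟨v, hv, k1, k2⟩
    obtain ⟨k3, k4⟩ := hcand v k1 k2
    exact h2 s h0 v hv k3 k4

theorem exists_constLE_list : ∀ es : List Expr, ∃ M, ∀ e ∈ es, e.ConstLE M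
  | [] => ⟨0, by simp⟩
  | e :: es => by
    obtain ⟨M, hM⟩ := e.exists_constLE
    obtain ⟨M', hM'⟩ := exists_constLE_list es
    refine ⟨max M M', fun f hf => ?_⟩
    rcases List.mem_cons.1 hf with rfl | hf
    exacts [hM.mono (le_max_left _ _), (hM' f hf).mono (le_max_right _ _)]

/-- Search with a list of tests. -/
theorem exists_search_tests {S T : ℕ → Set (ℤ × ℤ)} (hc : 1 ≤ c) (hN : 1 ≤ N) (hN' : 1 ≤ N')
    (hT : ∀ X, 2 ≤ X → Target X N N' c (T X)) {es : List Expr}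
    (h1 : ∀ X : ℕ, 2 ≤ X → ∀ s : State, s 0 = X → (∀ e ∈ es, 0 < e.eval s) →
      (s 16 / N, s 17 / N') ∈ S X ∧ (s 16 / N, -(s 17 / N')) ∈ S X)
    (h2 : ∀ X : ℕ, 2 ≤ X → ∀ s : State, s 0 = X → ∀ v ∈ T X, s 16 / N = v.1 → s 17 / N' = |v.2| →
      ∀ e ∈ es, 0 < e.eval s) :
    ∃ A : ℝ, 0 ≤ A ∧ ∀ X : ℕ, 2 ≤ X → ∃ (s' : State) (o : List (ℤ × ℤ)) (t : ℕ),
      Runs (searchProg c N (filterProg N N' es)) (input X) s' o t ∧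
      (t : ℝ) ≤ A * Real.sqrt X * Real.log X ^ 3 ∧ (o.length : ℝ) ≤ A * Real.sqrt X * Real.log X ∧
      (∀ v ∈ o, v ∈ S X) ∧ ∀ v ∈ T X, v ∈ o := by
  obtain ⟨M₁, hM₁⟩ := exists_constLE_list es
  refine exists_search (M₀ := M₁ + N + N') (filterWork_nonneg N N' es) hc hN hT
    fun M X hM₀ hM hX => filterSpec_filterProg hM hN hN' (by omega) (by omega)
      (fun e he => (hM₁ e he).mono (by omega)) (h1 X hX) (h2 X hX)

theorem exists_finds {S : ℕ → Set (ℤ × ℤ)} (hc : 1 ≤ c) (hN : 1 ≤ N) (hN' : 1 ≤ N')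
    (hT : ∀ X, 2 ≤ X → Target X N N' c (S X)) (hsymm : ∀ X x y, (x, y) ∈ S X → (x, -y) ∈ S X)
    {es : List Expr} (hes : ∀ X : ℕ, ∀ s : State, s 0 = X →
      ((∀ e ∈ es, 0 < e.eval s) ↔ (s 16 / N, s 17 / N') ∈ S X)) :
    ∃ (P : Prog) (A : ℝ), ∀ X : ℕ, 2 ≤ X →
      P.Finds X (S X) (A * Real.sqrt (X : ℝ) * Real.log (X : ℝ) ^ 3) := by
  obtain ⟨A, -, h⟩ := exists_search_tests (S := S) (T := S) hc hN hN' hT (es := es)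
    (fun X _ s h0 hpos => ⟨(hes X s h0).1 hpos, hsymm _ _ _ ((hes X s h0).1 hpos)⟩)
    (fun X _ s h0 v hv k1 k2 => by
      rw [hes X s h0, k1, k2]
      rcases abs_choice v.2 with h | h
      · rw [h]; exact hv
      · rw [h]; exact hsymm _ _ _ hv)
  refine ⟨searchProg c N (filterProg N N' es), A, fun X hX => ?_⟩
  obtain ⟨s', o, t, k1, k2, -, k4, k5⟩ := h X hX
  exact ⟨s', o, t, k1, fun v => ⟨k4 v, k5 v⟩, k2⟩

/-! ### The two search problems and the count -/

/-- The difference `a * x ^ 3 - b * y ^ 2` of the candidate. -/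
def diffExpr (a b N N' : ℕ) : Expr :=
  const a * (candX N * candX N * candX N) - const b * (candY N' * candY N')

theorem eval_diffExpr (a b N N' : ℕ) (s : State) : (diffExpr a b N N').eval s =
    a * (s 16 / N) ^ 3 - b * (s 17 / N') ^ 2 := by
  simp only [diffExpr, candX, candY, eval_sub, eval_mul, eval_div, eval_const, eval_reg]
  ring

theorem finds_sqrt (C : ℚ) (hC : 0 < C) : ∃ (P : Prog) (A : ℝ), ∀ X : ℕ, 2 ≤ X →
    P.Finds X
      {v : ℤ × ℤ | 0 ≤ v.1 ∧ v.1 ≤ (X : ℤ) ∧ 0 < |v.1 ^ 3 - v.2 ^ 2| ∧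
        ((|v.1 ^ 3 - v.2 ^ 2| : ℤ) : ℝ) ≤ (C : ℝ) * Real.sqrt (v.1 : ℝ)}
      (A * Real.sqrt (X : ℝ) * Real.log (X : ℝ) ^ 3) := by
  have hCr : (0 : ℝ) < C := by exact_mod_cast hC
  refine exists_finds (N := 1) (N' := 1) (c := ⌈C⌉₊) (Nat.one_le_iff_ne_zero.2 (by
      rw [← Nat.pos_iff_ne_zero]; exact Nat.ceil_pos.2 hC)) le_rfl le_rfl ?_ ?_
    -- Adding `1` expresses a weak inequality as positivity. The bound by `C √x` is squared and
    -- cleared of the denominator of `C`.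
    (es := [candX 1 + const 1, reg 0 - candX 1 + const 1, diffExpr 1 1 1 1 * diffExpr 1 1 1 1,
      const (C.num ^ 2) * candX 1 -
        const (C.den ^ 2) * (diffExpr 1 1 1 1 * diffExpr 1 1 1 1) + const 1]) ?_
  · rintro X - ⟨x, y⟩ ⟨h1, h2, h3, h4⟩
    simp only at h1 h2 h3 h4
    -- At `x = 0` the upper bound forces `y = 0`, which the strict lower bound excludes. For `x ≥ 1`
    -- the bound `C √x` is weaker than the linear one required by `Target`.
    have hx : 1 ≤ x := by
      by_contra hx
      obtain rfl : x = 0 := by omega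
      simp at h4
      have : y = 0 := by exact_mod_cast h4
      simp [this] at h3
    have hxr : (1 : ℝ) ≤ x := by exact_mod_cast hx
    refine ⟨by simpa using hx, by simpa using h2, ?_⟩
    simp only [Nat.cast_one, one_mul]
    have h5 : ((|x ^ 3 - y ^ 2| : ℤ) : ℝ) ≤ (⌈C⌉₊ : ℝ) * x := by
      refine h4.trans ?_
      have h6 : (C : ℝ) ≤ (⌈C⌉₊ : ℝ) := by exact_mod_cast Nat.le_ceil C
      have h7 : Real.sqrt x ≤ x := (Real.sqrt_le_left (by linarith)).2 (by nlinarith)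
      gcongr
    exact_mod_cast h5
  · intro X x y h
    simpa using h
  · intro X s h0
    set x := s 16 / ((1 : ℕ) : ℤ) with hx
    set y := s 17 / ((1 : ℕ) : ℤ) with hy
    have ed : (diffExpr 1 1 1 1).eval s = x ^ 3 - y ^ 2 := by
      rw [eval_diffExpr]; simp [hx, hy]
    have ex : (candX 1).eval s = x := rfl
    simp only [List.forall_mem_cons, List.not_mem_nil, false_implies, implies_true, and_true,
      eval_add, eval_sub, eval_mul, eval_const, eval_reg, ed, ex, h0, Set.mem_ofPred_eq]
    refine and_congr_right_iff.2 ?_ |>.trans (and_congr_left_iff.2 fun _ => by omega)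
    intro hx0
    refine and_congr (by omega) (and_congr (mul_self_pos.trans abs_pos.symm) ?_)
    have hxr : (0 : ℝ) ≤ x := by exact_mod_cast (by omega : 0 ≤ x)
    generalize x ^ 3 - y ^ 2 = u
    have hd : (0 : ℝ) < (C.den : ℝ) := by exact_mod_cast C.den_pos
    have hCe : (C : ℝ) = C.num / C.den := by exact_mod_cast (Rat.num_div_den C).symm
    have e1 : (C : ℝ) * Real.sqrt x = Real.sqrt ((C : ℝ) ^ 2 * x) := by
      rw [Real.sqrt_mul (sq_nonneg _), Real.sqrt_sq hCr.le]
    rw [e1, Real.le_sqrt (by positivity), hCe, div_pow, div_mul_eq_mul_div, le_div_iff₀ (by positivity)]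
    have e2 : ((|u| : ℤ) : ℝ) ^ 2 * (C.den : ℝ) ^ 2 ≤ (C.num : ℝ) ^ 2 * x ↔
        |u| ^ 2 * (C.den : ℤ) ^ 2 ≤ C.num ^ 2 * x := by exact_mod_cast Iff.rfl
    rw [e2, sq_abs]
    · constructor <;> intro h <;> linarith
    · positivity

/-- Reduction to `a = b = 1` by `(abx)^3 - (ab^2y)^2 = a^2b^3 (ax^3 - by^2)`; the linear bound
survives with constant `ab^2C`. -/
theorem finds_linear (a b : ℕ) (ha : 0 < a) (hb : 0 < b) (C : ℚ) (hC : 0 < C) :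
    ∃ (P : Prog) (A : ℝ), ∀ X : ℕ, 2 ≤ X →
      P.Finds X
        {v : ℤ × ℤ | v.1 ≤ (X : ℤ) ∧ 0 < |(a : ℤ) * v.1 ^ 3 - (b : ℤ) * v.2 ^ 2| ∧
          ((|(a : ℤ) * v.1 ^ 3 - (b : ℤ) * v.2 ^ 2| : ℤ) : ℚ) ≤ C * (v.1 : ℚ)}
        (A * Real.sqrt (X : ℝ) * Real.log (X : ℝ) ^ 3) := by
  have hab : 1 ≤ a * b := Nat.mul_pos ha hb
  have hab2 : 1 ≤ a * b ^ 2 := Nat.mul_pos ha (pow_pos hb 2)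
  have ha' : (0 : ℚ) < a := by exact_mod_cast ha
  have hb' : (0 : ℚ) < b := by exact_mod_cast hb
  refine exists_finds (N := a * b) (N' := a * b ^ 2) (c := ⌈a * b ^ 2 * C⌉₊)
    (Nat.one_le_iff_ne_zero.2 (by
      rw [← Nat.pos_iff_ne_zero]; exact Nat.ceil_pos.2 (by positivity))) hab hab2 ?_ ?_
    (es := [reg 0 - candX (a * b) + const 1,
      diffExpr a b (a * b) (a * b ^ 2) * diffExpr a b (a * b) (a * b ^ 2),
      const C.num * candX (a * b) - const C.den * diffExpr a b (a * b) (a * b ^ 2) + const 1,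
      const C.num * candX (a * b) + const C.den * diffExpr a b (a * b) (a * b ^ 2) + const 1]) ?_
  · rintro X - ⟨x, y⟩ ⟨h2, h3, h4⟩
    simp only at h2 h3 h4
    have hx : 0 < x := by
      have : (0 : ℚ) < C * x := lt_of_lt_of_le (by exact_mod_cast h3) h4
      exact_mod_cast (pos_iff_pos_of_mul_pos this).1 hC
    have hxr : (0 : ℚ) < x := by exact_mod_cast hx
    have habz : (1 : ℤ) ≤ (a * b : ℕ) := by exact_mod_cast hab
    refine ⟨by nlinarith, by simp only; gcongr, ?_⟩
    have h5 : ((|((a * b : ℕ) * x) ^ 3 - ((a * b ^ 2 : ℕ) * y) ^ 2| : ℤ) : ℚ) ≤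
        (⌈a * b ^ 2 * C⌉₊ : ℚ) * ((a * b : ℕ) * x) := by
      have e : ((a * b : ℕ) * x) ^ 3 - ((a * b ^ 2 : ℕ) * y) ^ 2 =
        ((a : ℤ) ^ 2 * b ^ 3) * (a * x ^ 3 - b * y ^ 2) := by push_cast; ring
      rw [e, abs_mul, abs_of_nonneg (by positivity)]
      have h6 := Nat.le_ceil (a * b ^ 2 * C)
      calc _ ≤ ((a : ℚ) ^ 2 * b ^ 3) * (C * x) := by
            rw [Int.cast_mul]; push_cast at h4 ⊢; gcongr
        _ = (a * b ^ 2 * C) * ((a * b : ℕ) * x) := by push_cast; ring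
        _ ≤ _ := by gcongr
    exact_mod_cast h5
  · intro X x y h
    simpa using h
  · intro X s h0
    set x := s 16 / ((a * b : ℕ) : ℤ) with hx
    set y := s 17 / ((a * b ^ 2 : ℕ) : ℤ) with hy
    have ed : (diffExpr a b (a * b) (a * b ^ 2)).eval s = a * x ^ 3 - b * y ^ 2 := eval_diffExpr ..
    have ex : (candX (a * b)).eval s = x := rfl
    simp only [List.forall_mem_cons, List.not_mem_nil, false_implies, implies_true, and_true,
      eval_add, eval_sub, eval_mul, eval_const, eval_reg, ed, ex, h0, Set.mem_ofPred_eq]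
    refine and_congr (by omega) (and_congr (mul_self_pos.trans abs_pos.symm) ?_)
    generalize (a : ℤ) * x ^ 3 - b * y ^ 2 = u
    have hd : (0 : ℚ) < (C.den : ℚ) := by exact_mod_cast C.den_pos
    have hCe : C * x = C.num * x / C.den := by
      rw [mul_div_right_comm, Rat.num_div_den]
    rw [hCe, le_div_iff₀ hd]
    have e2 : ((|u| : ℤ) : ℚ) * (C.den : ℚ) ≤ (C.num : ℚ) * x ↔
        |u| * (C.den : ℤ) ≤ C.num * x := by exact_mod_cast Iff.rfl
    have e3 : |u| * (C.den : ℤ) = |C.den * u| := by rw [abs_mul, Nat.abs_cast, mul_comm]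
    rw [e2, e3, abs_le]
    constructor
    · rintro ⟨h1, h2⟩; constructor <;> linarith
    · rintro ⟨h1, h2⟩; constructor <;> linarith

/-- With an empty list of tests the search writes every candidate, so the length of its output
bounds the number of pairs with `x ≥ 1`. Lengths are not multiplied by the cost of arithmetic, so
only one logarithm appears. -/
theorem count_le (C : ℝ) : ∃ A : ℝ, ∀ X : ℝ, 2 ≤ X →
    {v : ℤ × ℤ | (v.1 : ℝ) ≤ X ∧ ((|v.1 ^ 3 - v.2 ^ 2| : ℤ) : ℝ) ≤ C * (v.1 : ℝ)}.Finite ∧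
    ({v : ℤ × ℤ | (v.1 : ℝ) ≤ X ∧
      ((|v.1 ^ 3 - v.2 ^ 2| : ℤ) : ℝ) ≤ C * (v.1 : ℝ)}.ncard : ℝ) ≤
      A * Real.sqrt X * Real.log X := by
  obtain ⟨m, hm⟩ := exists_nat_gt |C|
  have hm1 : 1 ≤ m := by
    have : (0 : ℝ) < m := (abs_nonneg C).trans_lt hm
    exact_mod_cast this
  obtain ⟨A, hA, h⟩ := exists_search_tests (N := 1) (N' := 1) (c := m) (es := [])
    (S := fun _ => Set.univ)
    (T := fun X => {v : ℤ × ℤ | 1 ≤ v.1 ∧ v.1 ≤ X ∧ |v.1 ^ 3 - v.2 ^ 2| ≤ m * v.1})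
    hm1 le_rfl le_rfl (by rintro X - v ⟨h1, h2, h3⟩; simpa using ⟨h1, h2, h3⟩) (by simp) (by simp)
  -- For `x = -z ≤ 0` the condition gives `z^3 + y^2 ≤ m z`, hence `z ≤ m` and `|y| ≤ m`.
  set box : Finset (ℤ × ℤ) := Finset.Icc (-(m : ℤ)) m ×ˢ Finset.Icc (-(m : ℤ)) m with hbox
  refine ⟨A + 2 * box.card, fun X hX => ?_⟩
  have hfl : 2 ≤ ⌊X⌋₊ := Nat.le_floor (by exact_mod_cast hX)
  obtain ⟨s', o, t, -, -, k3, -, k5⟩ := h ⌊X⌋₊ hfl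
  have hsub : {v : ℤ × ℤ | (v.1 : ℝ) ≤ X ∧ ((|v.1 ^ 3 - v.2 ^ 2| : ℤ) : ℝ) ≤ C * (v.1 : ℝ)} ⊆
      (o.toFinset ∪ box : Finset (ℤ × ℤ)) := by
    rintro ⟨x, y⟩ ⟨h1, h2⟩
    simp only at h1 h2
    rw [Finset.coe_union]
    have hle : |x ^ 3 - y ^ 2| ≤ m * |x| := by
      have : ((|x ^ 3 - y ^ 2| : ℤ) : ℝ) ≤ m * |(x : ℝ)| := by
        refine h2.trans ((le_abs_self _).trans ?_)
        rw [abs_mul]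
        gcongr
      exact_mod_cast this
    rcases le_or_gt 1 x with hx | hx
    · left
      rw [abs_of_pos (by omega : 0 < x)] at hle
      have hxX : x ≤ (⌊X⌋₊ : ℤ) := by
        have h6 : x.toNat ≤ ⌊X⌋₊ := Nat.le_floor (by
          have : ((x.toNat : ℤ) : ℝ) = x := by rw [Int.toNat_of_nonneg (by omega)]
          rw [← this] at h1
          exact_mod_cast h1)
        omega
      simpa using k5 (x, y) ⟨hx, hxX, hle⟩
    · right
      obtain ⟨z, rfl⟩ : ∃ z, x = -z := ⟨-x, by ring⟩
      rw [abs_neg, abs_of_nonneg (by omega : 0 ≤ z)] at hle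
      have h5 : z ^ 3 + y ^ 2 ≤ m * z := by
        have := neg_abs_le ((-z) ^ 3 - y ^ 2)
        have e : (-z) ^ 3 = -z ^ 3 := by ring
        rw [e] at this hle
        linarith
      have hz : 0 ≤ z := by omega
      have hmz : (1 : ℤ) ≤ m := by exact_mod_cast hm1
      have hzm : z ≤ m := by
        by_contra hlt
        nlinarith [sq_nonneg y, mul_pos (by omega : 0 < z) (by omega : 0 < z)]
      have hym : |y| ≤ m := by
        apply abs_le_of_sq_le_sq _ (by omega)
        nlinarith [pow_nonneg hz 3]
      simp only [hbox, Finset.coe_product, Set.mem_prod, Finset.coe_Icc, Set.mem_Icc]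
      obtain ⟨h6, h7⟩ := abs_le.1 hym
      exact ⟨⟨by omega, by omega⟩, h6, h7⟩
  refine ⟨(Finset.finite_toSet _).subset hsub, ?_⟩
  have h1 := Set.ncard_le_ncard hsub (Finset.finite_toSet _)
  rw [Set.ncard_coe_finset] at h1
  have h2 : (o.toFinset ∪ box).card ≤ o.length + box.card :=
    (Finset.card_union_le _ _).trans (by gcongr; exact List.toFinset_card_le o)
  have hX0 : (⌊X⌋₊ : ℝ) ≤ X := Nat.floor_le (by linarith)
  have hf2 : (2 : ℝ) ≤ (⌊X⌋₊ : ℝ) := by exact_mod_cast hfl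
  have h3 : A * Real.sqrt ⌊X⌋₊ * Real.log ⌊X⌋₊ ≤ A * Real.sqrt X * Real.log X := by
    gcongr
  have h4 : 1 ≤ 2 * (Real.sqrt X * Real.log X) := by
    have := Real.log_two_gt_d9
    have h5 : Real.log 2 ≤ Real.log X := Real.log_le_log (by norm_num) hX
    have h6 : 1 ≤ Real.sqrt X := Real.one_le_sqrt.2 (by linarith)
    nlinarith
  have h5 : ((o.toFinset ∪ box).card : ℝ) ≤ o.length + box.card := by exact_mod_cast h2
  calc _ ≤ ((o.toFinset ∪ box).card : ℝ) := by exact_mod_cast h1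
    _ ≤ A * Real.sqrt X * Real.log X + box.card * 1 := by linarith
    _ ≤ A * Real.sqrt X * Real.log X + box.card * (2 * (Real.sqrt X * Real.log X)) := by gcongr
    _ = _ := by ring

end BitCost

theorem mainTheorem6 :
    (∃ B : ℕ, ∀ C : ℚ, 0 < C → ∃ (P : BitCost.Prog) (A : ℝ), ∀ X : ℕ, 2 ≤ X →
      P.Finds X
        {v : ℤ × ℤ | 0 ≤ v.1 ∧ v.1 ≤ (X : ℤ) ∧ 0 < |v.1 ^ 3 - v.2 ^ 2| ∧
          ((|v.1 ^ 3 - v.2 ^ 2| : ℤ) : ℝ) ≤ (C : ℝ) * Real.sqrt (v.1 : ℝ)}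
        (A * Real.sqrt (X : ℝ) * Real.log (X : ℝ) ^ B)) ∧
    (∃ B : ℕ, ∀ a b : ℕ, 0 < a → 0 < b → ∀ C : ℚ, 0 < C →
      ∃ (P : BitCost.Prog) (A : ℝ), ∀ X : ℕ, 2 ≤ X →
      P.Finds X
        {v : ℤ × ℤ | v.1 ≤ (X : ℤ) ∧ 0 < |(a : ℤ) * v.1 ^ 3 - (b : ℤ) * v.2 ^ 2| ∧
          ((|(a : ℤ) * v.1 ^ 3 - (b : ℤ) * v.2 ^ 2| : ℤ) : ℚ) ≤ C * (v.1 : ℚ)}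
        (A * Real.sqrt (X : ℝ) * Real.log (X : ℝ) ^ B)) ∧
    (∀ C : ℝ, ∃ A : ℝ, ∀ X : ℝ, 2 ≤ X →
      {v : ℤ × ℤ | (v.1 : ℝ) ≤ X ∧
        ((|v.1 ^ 3 - v.2 ^ 2| : ℤ) : ℝ) ≤ C * (v.1 : ℝ)}.Finite ∧
      ({v : ℤ × ℤ | (v.1 : ℝ) ≤ X ∧
        ((|v.1 ^ 3 - v.2 ^ 2| : ℤ) : ℝ) ≤ C * (v.1 : ℝ)}.ncard : ℝ) ≤
        A * Real.sqrt X * Real.log X) :=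
  ⟨⟨3, BitCost.finds_sqrt⟩, ⟨3, BitCost.finds_linear⟩, BitCost.count_le⟩
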